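/- Let $d\ge 1$, let $\phi$ be the standard univariate normal density, and for $\Gamma>0$ let $\mathcal G_1(\Gamma)$ be the set of all probability measures $G$ on $\mathbb R^d$ such that $G\{u:\|u\|>t\}\le \Gamma\exp(-t^2/\Gamma)$ for all $t>0$, where $\|\cdot\|$ is the Euclidean norm. Let $\mathcal F_{\mathcal G_1(\Gamma)}$ be the class of densities $$x\mapsto\int \phi(x_1-u_1)\cdots\phi(x_d-u_d)\,dG(u),\qquad G\in\mathcal G_1(\Gamma).$$ Let $h^2(f,g)=\int_{\mathbb R^d}(\sqrt{f(x)}-\sqrt{g(x)})^2\,dx$ be the squared Hellinger distance, and define the minimax risk $$R_n(\mathcal F_{\mathcal G_1(\Gamma)},h^2)=\inf_{\hat f_n}\ \sup_{f\in\mathcal F_{\mathcal G_1(\Gamma)}}\mathbb E_f\,h^2(\hat f_n,f),$$ where $\mathbb E_f$ is the expectation over i.i.d. observations $X_1,\dots,X_n$ with density $f$, and the infimum is over all estimators $\hat f_n$, i.e. all nonnegative functions $\hat f_n(x)=\hat f_n(x;X_1,\dots,X_n)$ that are jointly measurable in $(X_1,\dots,X_n,x)$ (not necessarily integrating to one). Then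 there is a constant $c_d>0$ depending only on $d$ such that $$R_n(\mathcal F_{\mathcal G_1(\Gamma)},h^2)\ \ge\ c_d\,\frac{(\log n)^d}{n}\qquad\text{for all }\Gamma\ge c_d^{-1}\text{ and all integers } n\ge 2.$$ -/

import Mathlib

open MeasureTheory ProbabilityTheory
open scoped ENNReal

noncomputable section

namespace GaussianMixture

/-- The Gaussian location mixture density on `ℝ^d` with mixing measure `G`:
`x ↦ ∫ φ(x₁ - u₁) ⋯ φ(x_d - u_d) dG(u)`, where `φ` is the standard normal density. -/
def mixtureDensity {d : ℕ} (G : Measure (EuclideanSpace ℝ (Fin d)))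
    (x : EuclideanSpace ℝ (Fin d)) : ℝ :=
  ∫ u, ∏ i, gaussianPDFReal 0 1 (x i - u i) ∂G

/-- The class of mixture densities whose mixing measure lies in `𝒢`. -/
def mixtureClass {d : ℕ} (𝒢 : Set (Measure (EuclideanSpace ℝ (Fin d)))) :
    Set (EuclideanSpace ℝ (Fin d) → ℝ) :=
  mixtureDensity '' 𝒢

/-- The probability measures `G` on `ℝ^d` with `G{‖u‖ > t} ≤ Γ exp(-t²/Γ)` for all `t > 0`. -/
def subGaussianMixing (d : ℕ) (Γ : ℝ) : Set (Measure (EuclideanSpace ℝ (Fin d))) :=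
  {G | IsProbabilityMeasure G ∧
    ∀ t : ℝ, 0 < t → G {u | t < ‖u‖} ≤ ENNReal.ofReal (Γ * Real.exp (-t ^ 2 / Γ))}

/-- Squared Hellinger distance `∫ (√f - √g)²` with respect to Lebesgue measure,
with values in `[0, ∞]`. -/
def hellingerSq {d : ℕ} (f g : EuclideanSpace ℝ (Fin d) → ℝ) : ℝ≥0∞ :=
  ∫⁻ x, ENNReal.ofReal ((Real.sqrt (f x) - Real.sqrt (g x)) ^ 2)

/-- The joint law of `n` i.i.d. observations with Lebesgue density `f`. -/
def iidLaw {d : ℕ} (n : ℕ) (f : EuclideanSpace ℝ (Fin d) → ℝ) :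
    Measure (Fin n → EuclideanSpace ℝ (Fin d)) :=
  Measure.pi fun _ => volume.withDensity fun x => ENNReal.ofReal (f x)

/-- An estimator of a density on `ℝ^d` from `n` observations: a nonnegative function of the sample
and of the point, jointly measurable. It is not required to integrate to one, so density-valued
estimators are a special case. -/
structure Estimator (d n : ℕ) where
  toFun : (Fin n → EuclideanSpace ℝ (Fin d)) → EuclideanSpace ℝ (Fin d) → ℝ
  nonneg : ∀ X x, 0 ≤ toFun X x
  measurable : Measurable (Function.uncurry toFun)

/-- The minimax risk `inf_{f̂} sup_{f ∈ ℱ} 𝔼_f h²(f̂, f)` for `n` i.i.d. observations. -/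
def minimaxHellingerRisk {d : ℕ} (n : ℕ) (ℱ : Set (EuclideanSpace ℝ (Fin d) → ℝ)) : ℝ≥0∞ :=
  ⨅ fhat : Estimator d n, ⨆ f ∈ ℱ, ∫⁻ X, hellingerSq (fhat.toFun X) f ∂(iidLaw n f)

end GaussianMixture

end

namespace GaussianMixture

/-! The bound is an Assouad argument over a cube of dimension `m ^ d` with `m` of order `log n`,
whose vertices are Gaussian mixtures perturbing a common product density.

In one dimension, take mixing measures on the grid `j / √m`, `0 ≤ j ≤ m`, with all but `exp (-m)` of
the mass at the origin. This keeps the tails sub-Gaussian with a constant depending only on the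
dimension, while every grid weight stays at least `exp (-m) / m`. Signed weights of total mass zero
form an `m`-dimensional space. Orthonormalise their Gaussian sums in `L²(1 / f₀)`, where `f₀` is the
base mixture. The crucial estimate, `abs_le_mul_sqrt_chiSqForm`, says that a sum of norm one has
weights at most `C ^ m` times the base weights. Indeed, such a sum at `√m τ` is a Gaussian factor
times a polynomial of degree at most `m` in `exp τ`. The norm bounds it at `m + 1` separated points,
and Lagrange interpolation (`abs_coeff_le_of_abs_eval_le`) recovers the coefficients with
exponential loss only.

Tensor products of these functions give `m ^ d` orthonormal directions in dimension `d`. Adding any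
subset of them with amplitude `ε` leaves a genuine mixing measure as long as `ε (m C ^ m) ^ d ≤ 1 /
2`. All vertices are then comparable to the base density, so squared Hellinger distance is, up to
constants, `ε ^ 2` times Hamming distance. With `ε` of order `n ^ (-1 / 2)`, neighbouring vertices
cannot be told apart from `n` observations, and the amplitude condition permits `m` of order `log
n`. `assouad_hellinger` then gives a risk of order `m ^ d ε ^ 2`, that is `(log n) ^ d / n`. -/

/-! ### Polynomial interpolation: coefficients from values -/

open Polynomial in
/-- The coefficients of a product of linear factors are bounded by the product of the sums of the
absolute values of their coefficients. -/
theorem abs_coeff_prod_linear_le {ι : Type*} (s : Finset ι) (a y : ι → ℝ) (j : ℕ) :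
    |(∏ k ∈ s, (C (a k) * (X - C (y k)))).coeff j| ≤ ∏ k ∈ s, |a k| * (1 + |y k|) := by
  classical
  induction s using Finset.induction_on generalizing j with
  | empty =>
    simp only [Finset.prod_empty, coeff_one]
    split_ifs <;> simp
  | insert i s hi ih =>
    rw [Finset.prod_insert hi, Finset.prod_insert hi, mul_assoc, coeff_C_mul, sub_mul, coeff_sub,
      coeff_C_mul, abs_mul, mul_assoc]
    set P := ∏ k ∈ s, (C (a k) * (X - C (y k)))
    set B := ∏ k ∈ s, |a k| * (1 + |y k|)
    have hB : 0 ≤ B := Finset.prod_nonneg fun k _ => by positivity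
    have h1 : |(X * P).coeff j| ≤ B := by
      cases j with
      | zero => simpa using hB
      | succ j => simpa using ih j
    have h2 : |y i * P.coeff j| ≤ |y i| * B := by
      rw [abs_mul]; exact mul_le_mul_of_nonneg_left (ih j) (abs_nonneg _)
    refine mul_le_mul_of_nonneg_left ?_ (abs_nonneg _)
    linarith [abs_sub ((X * P).coeff j) (y i * P.coeff j)]

theorem prod_erase_abs_sub_eq_factorial (i r : ℕ) :
    ∏ k ∈ (Finset.range (i + r + 1)).erase i, |(i : ℝ) - k| = (i.factorial * r.factorial : ℕ) := by
  induction r with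
  | zero =>
    have : (Finset.range (i + 0 + 1)).erase i = Finset.range i := by
      ext k; simp; omega
    rw [this, Nat.factorial_zero, mul_one, ← Finset.prod_range_add_one_eq_factorial,
      ← Finset.prod_range_reflect, Nat.cast_prod]
    refine Finset.prod_congr rfl fun k hk => ?_
    have hk := Finset.mem_range.1 hk
    obtain ⟨q, rfl⟩ := Nat.exists_eq_add_of_lt hk
    rw [show k + q + 1 - 1 - k = q by omega]
    push_cast
    rw [show (k : ℝ) + q + 1 - q = k + 1 by ring, abs_of_nonneg (by positivity)]
  | succ r ih =>
    have : (Finset.range (i + (r + 1) + 1)).erase i =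
        insert (i + r + 1) ((Finset.range (i + r + 1)).erase i) := by
      ext k; simp; omega
    rw [this, Finset.prod_insert (by simp), ih, Nat.factorial_succ]
    push_cast
    rw [abs_sub_comm, abs_of_nonneg (by linarith [(r.cast_nonneg : (0 : ℝ) ≤ r)])]
    ring

/-- The product equals `i! (m - i)!`, which is `m!` divided by a binomial coefficient, and that
coefficient is at most `2 ^ m`. It keeps the Lagrange denominators only exponentially smaller than
`m!`. -/
theorem factorial_le_two_pow_mul_prod {m i : ℕ} (hi : i ≤ m) :
    (m.factorial : ℝ) ≤ 2 ^ m * ∏ k ∈ (Finset.range (m + 1)).erase i, |(i : ℝ) - k| := by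
  obtain ⟨r, rfl⟩ := Nat.exists_eq_add_of_le hi
  rw [prod_erase_abs_sub_eq_factorial, ← Nat.choose_mul_factorial_mul_factorial hi,
    Nat.add_sub_cancel_left, mul_assoc]
  push_cast
  gcongr
  exact_mod_cast Nat.choose_le_two_pow _ _

open Polynomial in
/-- Coefficients of a polynomial of degree at most `m` are exponentially controlled by its values at
`m + 1` well separated points of `[-3, 3]`. -/
theorem abs_coeff_le_of_abs_eval_le {m : ℕ} (Q : ℝ[X]) (hQ : Q.degree < (m + 1 : ℕ)) (y : ℕ → ℝ)
    (M : ℝ) (hy : ∀ i ≤ m, |y i| ≤ 3)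
    (hsep : ∀ i ≤ m, ∀ k ≤ m, |(i : ℝ) - k| / (2 * (m + 1)) ≤ |y i - y k|)
    (hM : ∀ i ≤ m, |Q.eval (y i)| ≤ M) (j : ℕ) :
    |Q.coeff j| ≤ (m + 1) * (M * (16 ^ m * Real.exp (m + 1))) := by
  have hinj : Set.InjOn y (Finset.range (m + 1)) := by
    intro i hi k hk hik
    have hi := Finset.mem_range.1 hi
    have hk := Finset.mem_range.1 hk
    by_contra hne
    have h := hsep i (by omega) k (by omega)
    rw [hik, sub_self, abs_zero] at h
    have : 0 < |(i : ℝ) - k| := abs_pos.2 (sub_ne_zero.2 (by exact_mod_cast hne))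
    have : 0 < |(i : ℝ) - k| / (2 * (m + 1)) := by positivity
    linarith
  have hM0 : 0 ≤ M := (abs_nonneg _).trans (hM 0 (Nat.zero_le _))
  rw [Lagrange.eq_interpolate hinj (f := Q) (by simpa using hQ), Lagrange.interpolate_apply,
    finsetSum_coeff]
  refine (Finset.abs_sum_le_sum_abs _ _).trans ?_
  have key : ∀ i ∈ Finset.range (m + 1),
      |(C (Q.eval (y i)) * Lagrange.basis (Finset.range (m + 1)) y i).coeff j| ≤
        M * (16 ^ m * Real.exp (m + 1)) := by
    intro i hi
    have him : i ≤ m := Nat.lt_succ_iff.1 (Finset.mem_range.1 hi)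
    rw [coeff_C_mul, abs_mul]
    refine mul_le_mul (hM i him) ?_ (abs_nonneg _) hM0
    refine (abs_coeff_prod_linear_le _ _ _ _).trans ?_
    set s := (Finset.range (m + 1)).erase i
    have hs : s.card = m := by simp [s, hi]
    have hpos : ∀ k ∈ s, 0 < |(i : ℝ) - k| := fun k hk =>
      abs_pos.2 (sub_ne_zero.2 (by exact_mod_cast (Finset.ne_of_mem_erase hk).symm))
    -- The 8 is 2 from the separation hypothesis times 4 from `1 + |y k| ≤ 4`.
    have h1 : ∏ k ∈ s, |(y i - y k)⁻¹| * (1 + |y k|) ≤ ∏ k ∈ s, (8 * (m + 1)) / |(i : ℝ) - k| := by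
      refine Finset.prod_le_prod (fun k _ => by positivity) fun k hk => ?_
      have hkm : k ≤ m := Nat.lt_succ_iff.1 (Finset.mem_range.1 (Finset.mem_of_mem_erase hk))
      have h0 := hpos k hk
      have h0' : 0 < |(i : ℝ) - k| / (2 * (m + 1)) := by positivity
      have : (8 * (m + 1)) / |(i : ℝ) - k| = (|(i : ℝ) - k| / (2 * (m + 1)))⁻¹ * 4 := by
        field_simp; ring
      rw [this, abs_inv]
      exact mul_le_mul (inv_anti₀ h0' (hsep i him k hkm)) (by linarith [hy k hkm]) (by positivity)
        (by positivity)
    refine h1.trans ?_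
    rw [Finset.prod_div_distrib, Finset.prod_const, hs]
    have hprod : 0 < ∏ k ∈ s, |(i : ℝ) - k| := Finset.prod_pos hpos
    have hf := factorial_le_two_pow_mul_prod him
    -- The factor `(m + 1) ^ m` due to the spacing is absorbed by `m!` at exponential cost, so the
    -- total loss stays exponential in `m`.
    have hexp := Real.pow_div_factorial_le_exp (x := (m + 1 : ℝ)) (by positivity) m
    have hfac : (0 : ℝ) < m.factorial := by exact_mod_cast m.factorial_pos
    rw [div_le_iff₀ hfac] at hexp
    rw [div_le_iff₀ hprod, mul_pow]
    calc (8 : ℝ) ^ m * (m + 1) ^ m ≤ 8 ^ m * (Real.exp (m + 1) * m.factorial) := by gcongr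
      _ ≤ 8 ^ m * (Real.exp (m + 1) * (2 ^ m * ∏ k ∈ s, |(i : ℝ) - k|)) := by gcongr
      _ = _ := by rw [show (16 : ℝ) = 8 * 2 by norm_num, mul_pow]; ring
  refine (Finset.sum_le_sum key).trans ?_
  simp

/-! ### Gaussian sums as a finite-dimensional subspace of `L²(1 / f)` -/

/-- A positive definite symmetric bilinear form on a finite-dimensional real space has an
orthonormal basis. -/
theorem exists_orthonormal_of_posDef {V : Type*} [AddCommGroup V] [Module ℝ V]
    [FiniteDimensional ℝ V] (B : LinearMap.BilinForm ℝ V) (hsymm : ∀ x y, B x y = B y x)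
    (hnonneg : ∀ x, 0 ≤ B x x) (hdef : ∀ x, B x x = 0 → x = 0) :
    ∃ b : Fin (Module.finrank ℝ V) → V, ∀ i j, B (b i) (b j) = if i = j then 1 else 0 := by
  let core : InnerProductSpace.Core ℝ V :=
    { inner := fun x y => B x y
      conj_inner_symm := fun x y => by simp [hsymm x y]
      re_inner_nonneg := fun x => by simpa using hnonneg x
      add_left := fun x y z => by simp
      smul_left := fun x y r => by simp
      definite := hdef }
  let _ : NormedAddCommGroup V := core.toNormedAddCommGroup
  let _ : InnerProductSpace ℝ V := InnerProductSpace.ofCore core.toCore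
  refine ⟨stdOrthonormalBasis ℝ V, fun i j => ?_⟩
  exact orthonormal_iff_ite.1 (stdOrthonormalBasis ℝ V).orthonormal i j

/-- The combination `x ↦ ∑ j, w j φ(x - a j)` of Gaussian densities centred at the points `a j`. -/
noncomputable def gaussianSum {ι : Type*} [Fintype ι] (a w : ι → ℝ) (x : ℝ) : ℝ :=
  ∑ j, w j * gaussianPDFReal 0 1 (x - a j)

section GaussianSum

variable {ι : Type*} [Fintype ι] {a p : ι → ℝ}

theorem continuous_gaussianPDFReal_zero_one : Continuous (gaussianPDFReal 0 1) := by
  rw [gaussianPDFReal_def]; fun_prop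

theorem continuous_gaussianSum (a w : ι → ℝ) : Continuous (gaussianSum a w) := by
  have := continuous_gaussianPDFReal_zero_one
  unfold gaussianSum
  fun_prop

theorem integrable_gaussianSum (a w : ι → ℝ) : Integrable (gaussianSum a w) :=
  integrable_finsetSum _ fun j _ =>
    ((integrable_gaussianPDFReal 0 1).comp_sub_right (a j)).const_mul (w j)

theorem integral_gaussianSum (a w : ι → ℝ) : ∫ x, gaussianSum a w x = ∑ j, w j := by
  unfold gaussianSum
  rw [integral_finsetSum _ fun j _ =>
    ((integrable_gaussianPDFReal 0 1).comp_sub_right (a j)).const_mul (w j)]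
  refine Finset.sum_congr rfl fun j _ => ?_
  rw [integral_const_mul, integral_sub_right_eq_self (gaussianPDFReal 0 1) (a j),
    integral_gaussianPDFReal_eq_one 0 one_ne_zero, mul_one]

theorem gaussianSum_pos [Nonempty ι] (hp : ∀ j, 0 < p j) (x : ℝ) : 0 < gaussianSum a p x :=
  Finset.sum_pos (fun j _ => mul_pos (hp j) (gaussianPDFReal_pos _ _ _ one_ne_zero))
    Finset.univ_nonempty

theorem gaussianPDFReal_zero_one_le_one (x : ℝ) : gaussianPDFReal 0 1 x ≤ 1 := by
  rw [gaussianPDFReal]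
  refine mul_le_one₀ (inv_le_one_of_one_le₀ ?_) (Real.exp_pos _).le (Real.exp_le_one_iff.2 ?_)
  · rw [Real.one_le_sqrt]
    have := Real.pi_gt_three
    simp only [NNReal.coe_one]
    linarith
  · simp only [sub_zero, NNReal.coe_one]
    have := sq_nonneg x
    linarith

theorem gaussianSum_le_one (hp : ∀ j, 0 < p j) (hp1 : ∑ j, p j = 1) (x : ℝ) :
    gaussianSum a p x ≤ 1 := by
  rw [← hp1]
  exact Finset.sum_le_sum fun j _ =>
    mul_le_of_le_one_right (hp j).le (gaussianPDFReal_zero_one_le_one _)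

theorem abs_gaussianSum_le {c : ι → ℝ} {K : ℝ} (hc : ∀ j, |c j| ≤ K * p j) (x : ℝ) :
    |gaussianSum a c x| ≤ K * gaussianSum a p x := by
  unfold gaussianSum
  rw [Finset.mul_sum]
  refine (Finset.abs_sum_le_sum_abs _ _).trans (Finset.sum_le_sum fun j _ => ?_)
  rw [abs_mul, abs_of_nonneg (gaussianPDFReal_nonneg 0 1 _), ← mul_assoc]
  exact mul_le_mul_of_nonneg_right (hc j) (gaussianPDFReal_nonneg 0 1 _)

theorem exists_abs_le_mul (hp : ∀ j, 0 < p j) (c : ι → ℝ) : ∃ K, 0 ≤ K ∧ ∀ j, |c j| ≤ K * p j := by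
  refine ⟨∑ j, |c j| / p j, Finset.sum_nonneg fun j _ => div_nonneg (abs_nonneg _) (hp j).le,
    fun j => ?_⟩
  rw [← div_le_iff₀ (hp j)]
  exact Finset.single_le_sum (f := fun j => |c j| / p j)
    (fun j _ => div_nonneg (abs_nonneg _) (hp j).le) (Finset.mem_univ j)

theorem continuous_gaussianSum_mul_div [Nonempty ι] (hp : ∀ j, 0 < p j) (c c' : ι → ℝ) :
    Continuous fun x => gaussianSum a c x * gaussianSum a c' x / gaussianSum a p x :=
  ((continuous_gaussianSum a c).mul (continuous_gaussianSum a c')).div (continuous_gaussianSum a p)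
    fun x => (gaussianSum_pos hp x).ne'

/-- All base weights are positive, so each numerator factor is dominated by a multiple of the
denominator, and the quotient by an integrable Gaussian sum. -/
theorem integrable_gaussianSum_mul_div [Nonempty ι] (hp : ∀ j, 0 < p j) (c c' : ι → ℝ) :
    Integrable fun x => gaussianSum a c x * gaussianSum a c' x / gaussianSum a p x := by
  obtain ⟨K, hK0, hK⟩ := exists_abs_le_mul hp c
  obtain ⟨K', hK0', hK'⟩ := exists_abs_le_mul hp c'
  refine ((integrable_gaussianSum a p).const_mul (K * K')).mono'
    (continuous_gaussianSum_mul_div hp c c').aestronglyMeasurable (Filter.Eventually.of_forall ?_)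
  intro x
  have h0 := gaussianSum_pos (a := a) hp x
  rw [Real.norm_eq_abs, abs_div, abs_mul, abs_of_pos h0, div_le_iff₀ h0]
  calc |gaussianSum a c x| * |gaussianSum a c' x|
      ≤ (K * gaussianSum a p x) * (K' * gaussianSum a p x) :=
        mul_le_mul (abs_gaussianSum_le hK x) (abs_gaussianSum_le hK' x) (abs_nonneg _)
          (mul_nonneg hK0 h0.le)
    _ = _ := by ring

theorem gaussianSum_add (a c c' : ι → ℝ) (x : ℝ) :
    gaussianSum a (c + c') x = gaussianSum a c x + gaussianSum a c' x := by
  simp [gaussianSum, add_mul, Finset.sum_add_distrib]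

theorem gaussianSum_smul (a : ι → ℝ) (r : ℝ) (c : ι → ℝ) (x : ℝ) :
    gaussianSum a (r • c) x = r * gaussianSum a c x := by
  simp [gaussianSum, Finset.mul_sum, mul_assoc]

/-- The inner product of the Gaussian sums with weights `c` and `c'` in `L²(1 / f)`, where `f` is
the Gaussian sum with weights `p`. -/
noncomputable def chiSqForm [Nonempty ι] (a : ι → ℝ) (hp : ∀ j, 0 < p j) :
    LinearMap.BilinForm ℝ (ι → ℝ) :=
  LinearMap.mk₂ ℝ (fun c c' => ∫ x, gaussianSum a c x * gaussianSum a c' x / gaussianSum a p x)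
    (fun c₁ c₂ c' => by
      rw [← integral_add (integrable_gaussianSum_mul_div hp _ _)
        (integrable_gaussianSum_mul_div hp _ _)]
      simp only [gaussianSum_add, add_mul, add_div])
    (fun r c c' => by
      rw [smul_eq_mul, ← integral_const_mul]
      simp only [gaussianSum_smul, mul_assoc, mul_div_assoc])
    (fun c c₁ c₂ => by
      rw [← integral_add (integrable_gaussianSum_mul_div hp _ _)
        (integrable_gaussianSum_mul_div hp _ _)]
      simp only [gaussianSum_add, mul_add, add_div])
    (fun r c c' => by
      rw [smul_eq_mul, ← integral_const_mul]
      congr 1 with x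
      rw [gaussianSum_smul]
      ring)

theorem chiSqForm_apply [Nonempty ι] (hp : ∀ j, 0 < p j) (c c' : ι → ℝ) :
    chiSqForm a hp c c' =
      ∫ x, gaussianSum a c x * gaussianSum a c' x / gaussianSum a p x := rfl

theorem chiSqForm_comm [Nonempty ι] (hp : ∀ j, 0 < p j) (c c' : ι → ℝ) :
    chiSqForm a hp c c' = chiSqForm a hp c' c := by
  simp only [chiSqForm_apply, mul_comm]

theorem chiSqForm_self_nonneg [Nonempty ι] (hp : ∀ j, 0 < p j) (c : ι → ℝ) :
    0 ≤ chiSqForm a hp c c :=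
  integral_nonneg fun x => div_nonneg (mul_self_nonneg _) (gaussianSum_pos hp x).le

/-- On every interval there is a point at which a Gaussian sum is controlled by its norm. -/
theorem exists_sq_gaussianSum_le [Nonempty ι] (hp : ∀ j, 0 < p j) (hp1 : ∑ j, p j = 1)
    (c : ι → ℝ) {l r : ℝ} (hlr : l < r) :
    ∃ x ∈ Set.Icc l r, (r - l) * gaussianSum a c x ^ 2 ≤ chiSqForm a hp c c := by
  have hint := integrable_gaussianSum_mul_div (a := a) hp c c
  have hvol : volume.real (Set.Icc l r) = r - l := by simp [Measure.real, hlr.le]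
  obtain ⟨x, hx, hle⟩ := exists_le_setAverage (μ := volume) (s := Set.Icc l r)
    (f := fun x => gaussianSum a c x * gaussianSum a c x / gaussianSum a p x)
    (by simp [hlr]) (by simp) hint.integrableOn
  refine ⟨x, hx, ?_⟩
  have h0 := gaussianSum_pos (a := a) hp x
  -- The density is at most one, so dividing by it only increases the square.
  have h1 : gaussianSum a c x ^ 2 ≤ gaussianSum a c x * gaussianSum a c x / gaussianSum a p x := by
    rw [le_div_iff₀ h0, ← sq]
    exact mul_le_of_le_one_right (sq_nonneg _) (gaussianSum_le_one hp hp1 x)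
  rw [setAverage_eq, hvol, smul_eq_mul] at hle
  have hrl : 0 < r - l := sub_pos.2 hlr
  calc (r - l) * gaussianSum a c x ^ 2
      ≤ (r - l) * ((r - l)⁻¹ * ∫ x in Set.Icc l r,
          gaussianSum a c x * gaussianSum a c x / gaussianSum a p x) :=
        mul_le_mul_of_nonneg_left (h1.trans hle) hrl.le
    _ = ∫ x in Set.Icc l r, gaussianSum a c x * gaussianSum a c x / gaussianSum a p x := by
        field_simp
    _ ≤ _ := setIntegral_le_integral hint (Filter.Eventually.of_forall fun x =>
        div_nonneg (mul_self_nonneg _) (gaussianSum_pos hp x).le)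

end GaussianSum

/-! ### The grid, and exponential control of weights by the norm -/

/-- The grid `j / √m`, `0 ≤ j ≤ m`, of the support points of the mixing measures. -/
noncomputable def gridPoint (m : ℕ) (j : Fin (m + 1)) : ℝ := j / √m

/-- The base weights on the grid: most of the mass sits at the origin. -/
noncomputable def gridWeight (m : ℕ) (j : Fin (m + 1)) : ℝ :=
  if j = 0 then 1 - Real.exp (-m) else Real.exp (-m) / m

theorem gridPoint_zero (m : ℕ) : gridPoint m 0 = 0 := by simp [gridPoint]

theorem gridPoint_sq_le {m : ℕ} (hm : 1 ≤ m) (j : Fin (m + 1)) : gridPoint m j ^ 2 ≤ m := by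
  have hm0 : (0 : ℝ) < m := by exact_mod_cast hm
  have hj : (j : ℝ) ≤ m := by exact_mod_cast Nat.lt_succ_iff.1 j.2
  rw [gridPoint, div_pow, Real.sq_sqrt hm0.le, div_le_iff₀ hm0, ← sq]
  gcongr

theorem exp_neg_div_le_gridWeight {m : ℕ} (hm : 1 ≤ m) (j : Fin (m + 1)) :
    Real.exp (-m) / m ≤ gridWeight m j := by
  rw [gridWeight]
  split_ifs
  · have hm1 : (1 : ℝ) ≤ m := by exact_mod_cast hm
    have h1 : Real.exp (-m) ≤ 1 / 2 := by
      rw [Real.exp_neg, inv_le_comm₀ (Real.exp_pos _) (by norm_num)]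
      linarith [Real.add_one_le_exp (m : ℝ)]
    have h2 : Real.exp (-m) / m ≤ Real.exp (-m) := div_le_self (Real.exp_pos _).le hm1
    linarith
  · exact le_rfl

theorem gridWeight_pos {m : ℕ} (hm : 1 ≤ m) (j : Fin (m + 1)) : 0 < gridWeight m j :=
  lt_of_lt_of_le (div_pos (Real.exp_pos _) (by exact_mod_cast hm)) (exp_neg_div_le_gridWeight hm j)

theorem sum_gridWeight {m : ℕ} (hm : 1 ≤ m) : ∑ j, gridWeight m j = 1 := by
  have hm0 : (m : ℝ) ≠ 0 := by positivity
  rw [Fin.sum_univ_succ]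
  simp only [gridWeight, if_true, Fin.succ_ne_zero, if_false, Finset.sum_const, Finset.card_univ,
    Fintype.card_fin, nsmul_eq_mul]
  field_simp
  ring

open Polynomial in
/-- The weights of a Gaussian sum on the grid are exponentially controlled by its norm. -/
theorem abs_le_mul_sqrt_chiSqForm {m : ℕ} (hm : 1 ≤ m) (c : Fin (m + 1) → ℝ) (j : Fin (m + 1)) :
    |c j| ≤ (262144 ^ m * √(chiSqForm (gridPoint m) (gridWeight_pos hm) c c)) * gridWeight m j := by
  have hm0 : (0 : ℝ) < m := by exact_mod_cast hm
  have hm1 : (1 : ℝ) ≤ m := by exact_mod_cast hm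
  set N := chiSqForm (gridPoint m) (gridWeight_pos hm) c c with hN
  have hN0 : 0 ≤ N := chiSqForm_self_nonneg _ c
  set s := √(m : ℝ) with hs
  have hs0 : 0 < s := Real.sqrt_pos.2 hm0
  have hs1 : 1 ≤ s := Real.one_le_sqrt.2 hm1
  have hss : s * s = m := Real.mul_self_sqrt hm0.le
  -- One evaluation point is picked in the left half of each cell of width `1 / (m + 1)`. The unused
  -- right halves provide the separation `(i - k) / (2 (m + 1))`.
  have hex : ∀ i : ℕ, ∃ t ∈ Set.Icc ((i : ℝ) / (m + 1)) ((i + 1 / 2) / (m + 1)),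
      s / (2 * (m + 1)) * gaussianSum (gridPoint m) c (s * t) ^ 2 ≤ N := by
    intro i
    obtain ⟨x, hx, hle⟩ := exists_sq_gaussianSum_le (a := gridPoint m) (gridWeight_pos hm)
      (sum_gridWeight hm) c (l := s * (i / (m + 1))) (r := s * ((i + 1 / 2) / (m + 1)))
      (by gcongr; linarith)
    refine ⟨x / s, ⟨?_, ?_⟩, ?_⟩
    · rw [le_div_iff₀ hs0]; linarith [hx.1]
    · rw [div_le_iff₀ hs0]; linarith [hx.2]
    · rw [mul_div_cancel₀ _ hs0.ne']
      convert hle using 2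
      field_simp
      ring
  choose t ht hNt using hex
  -- Expanding the square in `φ (s τ - k / s)`, with `s ^ 2 = m`, turns the cross term into `exp (k
  -- τ)`: the sum becomes a polynomial in `exp τ`.
  let Q : ℝ[X] := ∑ k : Fin (m + 1), C (c k * Real.exp (-((k : ℝ) ^ 2 / m) / 2)) * X ^ (k : ℕ)
  have hcoeff : Q.coeff j = c j * Real.exp (-((j : ℝ) ^ 2 / m) / 2) := by
    simp only [Q, finsetSum_coeff, coeff_C_mul, coeff_X_pow, mul_ite, mul_one, mul_zero]
    rw [Finset.sum_eq_single j]
    · simp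
    · intro k _ hk; rw [if_neg]; exact fun h => hk (Fin.ext h.symm)
    · simp
  have heval : ∀ τ : ℝ, gaussianSum (gridPoint m) c (s * τ) =
      gaussianPDFReal 0 1 (s * τ) * Q.eval (Real.exp τ) := by
    intro τ
    simp only [Q, eval_finsetSum, eval_mul, eval_C, eval_pow, eval_X, Finset.mul_sum, gaussianSum]
    refine Finset.sum_congr rfl fun k _ => ?_
    simp only [gaussianPDFReal, gridPoint, ← hs, NNReal.coe_one, sub_zero, mul_one]
    rw [← Real.exp_nat_mul]
    have : Real.exp (-(s * τ - k / s) ^ 2 / 2) = Real.exp (-(s * τ) ^ 2 / 2) *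
        (Real.exp (-((k : ℝ) ^ 2 / m) / 2) * Real.exp (k * τ)) := by
      rw [← Real.exp_add, ← Real.exp_add, ← hss]
      congr 1
      field_simp
      ring
    rw [this]
    ring
  have ht0 : ∀ i, 0 ≤ t i := fun i => le_trans (by positivity) (ht i).1
  have ht1 : ∀ i ≤ m, t i ≤ 1 := fun i hi => (ht i).2.trans (by
    have : (i : ℝ) ≤ m := by exact_mod_cast hi
    rw [div_le_one (by positivity)]; linarith)
  have hdeg : Q.degree < (m + 1 : ℕ) := by
    refine lt_of_le_of_lt (degree_sum_le _ _) ?_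
    rw [Finset.sup_lt_iff (by exact WithBot.bot_lt_coe _)]
    exact fun k _ => lt_of_le_of_lt (degree_C_mul_X_pow_le _ _) (by exact_mod_cast k.2)
  -- The exponential does not contract distances on the nonnegative half-line, so the separation of
  -- the `t i` passes to the nodes `exp (t i)`.
  have hexpmono : ∀ u v : ℝ, 0 ≤ v → v ≤ u → u - v ≤ Real.exp u - Real.exp v := by
    intro u v hv huv
    have h1 := Real.add_one_le_exp (u - v)
    have h2 : Real.exp u = Real.exp v * Real.exp (u - v) := by rw [← Real.exp_add]; ring_nf
    have h3 := Real.one_le_exp hv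
    rw [h2]
    nlinarith
  have hsepaux : ∀ i k : ℕ, k < i →
      ((i : ℝ) - k) / (2 * (m + 1)) ≤ Real.exp (t i) - Real.exp (t k) := by
    intro i k hki
    have hki' : (k : ℝ) + 1 ≤ i := by exact_mod_cast hki
    have h1 : ((i : ℝ) - k) / (2 * (m + 1)) ≤ t i - t k := by
      have h2 := (ht i).1
      have h3 := (ht k).2
      have h4 : ((i : ℝ) - k) / (2 * (m + 1)) ≤ i / (m + 1) - (k + 1 / 2) / (m + 1) := by
        rw [← sub_div, div_le_div_iff₀ (by positivity) (by positivity)]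
        nlinarith
      linarith
    have h5 : 0 ≤ ((i : ℝ) - k) / (2 * (m + 1)) := by
      apply div_nonneg <;> linarith
    exact h1.trans (hexpmono _ _ (ht0 k) (by linarith))
  have hsep : ∀ i ≤ m, ∀ k ≤ m,
      |(i : ℝ) - k| / (2 * (m + 1)) ≤ |Real.exp (t i) - Real.exp (t k)| := by
    intro i _ k _
    rcases lt_trichotomy i k with h | h | h
    · rw [abs_sub_comm, abs_sub_comm (Real.exp _), abs_of_nonneg
        (sub_nonneg.2 (by exact_mod_cast h.le))]
      exact (hsepaux k i h).trans (le_abs_self _)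
    · simp [h]
    · rw [abs_of_nonneg (sub_nonneg.2 (by exact_mod_cast h.le))]
      exact (hsepaux i k h).trans (le_abs_self _)
  have hexp1 : Real.exp 1 ≤ 3 := by linarith [Real.exp_one_lt_d9]
  have hexpm : Real.exp (m / 2) ≤ 2 ^ m := by
    have : Real.exp (m / 2) = Real.exp (1 / 2) ^ m := by rw [← Real.exp_nat_mul]; ring_nf
    rw [this]
    refine pow_le_pow_left₀ (Real.exp_pos _).le ?_ m
    refine le_of_sq_le_sq ?_ (by norm_num)
    rw [← Real.exp_nat_mul]
    norm_num
    linarith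
  have hmpow : (m : ℝ) + 1 ≤ 2 ^ m := by
    exact_mod_cast Nat.lt_two_pow_self (n := m)
  have hM : ∀ i ≤ m, |Q.eval (Real.exp (t i))| ≤ 3 * 2 ^ m * (2 * 2 ^ m * √N) := by
    intro i hi
    have h1 : |gaussianSum (gridPoint m) c (s * t i)| ≤ 2 * 2 ^ m * √N := by
      refine abs_le_of_sq_le_sq ?_ (by positivity)
      rw [mul_pow, Real.sq_sqrt hN0]
      have h2 := hNt i
      have h3 : s * gaussianSum (gridPoint m) c (s * t i) ^ 2 ≤ N * (2 * (m + 1)) := by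
        rw [div_mul_eq_mul_div, div_le_iff₀ (by positivity)] at h2
        exact h2
      have h4 : (1 : ℝ) ≤ 2 ^ m := one_le_pow₀ (by norm_num)
      nlinarith [sq_nonneg (gaussianSum (gridPoint m) c (s * t i)),
        mul_le_mul_of_nonneg_left hmpow hN0, mul_nonneg hN0 (sub_nonneg.2 h4)]
    rw [heval, abs_mul] at h1
    -- Dividing out the Gaussian factor costs only `3 * 2 ^ m`, because `(s * t i) ^ 2 ≤ m`.
    have h5 : 1 ≤ 3 * 2 ^ m * |gaussianPDFReal 0 1 (s * t i)| := by
      rw [abs_of_nonneg (gaussianPDFReal_nonneg _ _ _), gaussianPDFReal]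
      simp only [sub_zero, NNReal.coe_one, mul_one]
      have hsq : √(2 * Real.pi) ≤ 3 := by
        rw [Real.sqrt_le_left (by norm_num)]
        linarith [Real.pi_lt_four]
      have h6 : 1 ≤ 3 * (√(2 * Real.pi))⁻¹ := by
        rw [← div_eq_mul_inv, one_le_div (by positivity)]; exact hsq
      have h7 : 1 ≤ 2 ^ m * Real.exp (-(s * t i) ^ 2 / 2) := by
        have : -((m : ℝ) / 2) ≤ -(s * t i) ^ 2 / 2 := by
          rw [mul_pow, sq s, hss]
          have := ht1 i hi
          have := ht0 i
          have : t i ^ 2 ≤ 1 := by nlinarith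
          nlinarith
        calc (1 : ℝ) = Real.exp (m / 2) * Real.exp (-(m / 2)) := by
              rw [← Real.exp_add]; simp
          _ ≤ _ := mul_le_mul hexpm (Real.exp_le_exp.2 this) (Real.exp_pos _).le (by positivity)
      calc (1 : ℝ) ≤ (3 * (√(2 * Real.pi))⁻¹) * (2 ^ m * Real.exp (-(s * t i) ^ 2 / 2)) :=
            one_le_mul_of_one_le_of_one_le h6 h7
        _ = _ := by ring
    calc |Q.eval (Real.exp (t i))|
        ≤ (3 * 2 ^ m * |gaussianPDFReal 0 1 (s * t i)|) * |Q.eval (Real.exp (t i))| :=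
          le_mul_of_one_le_left (abs_nonneg _) h5
      _ = 3 * 2 ^ m * (|gaussianPDFReal 0 1 (s * t i)| * |Q.eval (Real.exp (t i))|) := by ring
      _ ≤ _ := by gcongr
  have hQj := abs_coeff_le_of_abs_eval_le Q hdeg (fun i => Real.exp (t i)) _
    (fun i hi => by
      rw [abs_of_pos (Real.exp_pos _)]
      exact (Real.exp_le_exp.2 (ht1 i hi)).trans hexp1) hsep hM j
  rw [hcoeff, abs_mul, abs_of_pos (Real.exp_pos _)] at hQj
  have hjm : (j : ℝ) ≤ m := by exact_mod_cast Nat.lt_succ_iff.1 j.2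
  have h8 : 1 ≤ 2 ^ m * Real.exp (-((j : ℝ) ^ 2 / m) / 2) := by
    have : -((m : ℝ) / 2) ≤ -((j : ℝ) ^ 2 / m) / 2 := by
      have : (j : ℝ) ^ 2 / m ≤ m := by
        rw [div_le_iff₀ hm0, ← sq]; gcongr
      linarith
    calc (1 : ℝ) = Real.exp (m / 2) * Real.exp (-(m / 2)) := by
          rw [← Real.exp_add]; simp
      _ ≤ _ := mul_le_mul hexpm (Real.exp_le_exp.2 this) (Real.exp_pos _).le (by positivity)
  have hexpm4 : Real.exp m ≤ 4 ^ m := by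
    have : Real.exp m = Real.exp (m / 2) * Real.exp (m / 2) := by rw [← Real.exp_add]; ring_nf
    rw [this, show (4 : ℝ) = 2 * 2 by norm_num, mul_pow]
    gcongr
  have h9 : 1 ≤ 8 ^ m * gridWeight m j := by
    have h10 : 1 ≤ 8 ^ m * (Real.exp (-m) / m) := by
      rw [Real.exp_neg, show (8 : ℝ) ^ m * ((Real.exp m)⁻¹ / m) = 8 ^ m / (Real.exp m * m) by
        field_simp, one_le_div (by positivity), show (8 : ℝ) = 4 * 2 by norm_num, mul_pow]
      gcongr
      linarith
    exact h10.trans (mul_le_mul_of_nonneg_left (exp_neg_div_le_gridWeight hm j) (by positivity))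
  -- Bookkeeping: the exponential factors multiply to `1024 ^ m`, the constants to 18. With `8 ^ m`
  -- from the grid weight, the base is `32 * 1024 * 8 = 262144`.
  have h11 : (18 : ℝ) ≤ 32 ^ m := by
    calc (18 : ℝ) ≤ 32 ^ 1 := by norm_num
      _ ≤ 32 ^ m := pow_le_pow_right₀ (by norm_num) hm
  calc |c j| ≤ |c j| * (2 ^ m * Real.exp (-((j : ℝ) ^ 2 / m) / 2)) :=
        le_mul_of_one_le_right (abs_nonneg _) h8
    _ = 2 ^ m * (|c j| * Real.exp (-((j : ℝ) ^ 2 / m) / 2)) := by ring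
    _ ≤ 2 ^ m * ((m + 1) * (3 * 2 ^ m * (2 * 2 ^ m * √N) * (16 ^ m * Real.exp (m + 1)))) := by
        gcongr
    _ ≤ 2 ^ m * (2 ^ m * (3 * 2 ^ m * (2 * 2 ^ m * √N) * (16 ^ m * (4 ^ m * 3)))) := by
        rw [Real.exp_add]
        gcongr
    _ = 18 * (2 ^ m * 2 ^ m * 2 ^ m * 2 ^ m * 16 ^ m * 4 ^ m) * √N := by ring
    _ ≤ 32 ^ m * (2 ^ m * 2 ^ m * 2 ^ m * 2 ^ m * 16 ^ m * 4 ^ m) * √N := by gcongr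
    _ = 32768 ^ m * √N := by
        simp only [← mul_pow]; norm_num
    _ ≤ 32768 ^ m * √N * (8 ^ m * gridWeight m j) := le_mul_of_one_le_right (by positivity) h9
    _ = 262144 ^ m * √N * gridWeight m j := by
        rw [show (262144 : ℝ) = 32768 * 8 by norm_num, mul_pow]; ring

/-- An orthonormal system of `m` Gaussian sums of total mass zero on the grid, with exponentially
controlled weights. -/
theorem exists_orthonormal_gaussianSum {m : ℕ} (hm : 1 ≤ m) :
    ∃ c : Fin m → Fin (m + 1) → ℝ, (∀ k, ∑ j, c k j = 0) ∧
      (∀ k j, |c k j| ≤ 262144 ^ m * gridWeight m j) ∧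
      ∀ k l, ∫ x, gaussianSum (gridPoint m) (c k) x * gaussianSum (gridPoint m) (c l) x /
        gaussianSum (gridPoint m) (gridWeight m) x = if k = l then 1 else 0 := by
  -- Mass-zero weights are parametrised by their values off the origin; the weight at the origin
  -- balances them.
  let T : (Fin m → ℝ) →ₗ[ℝ] (Fin (m + 1) → ℝ) :=
    { toFun := fun b => Fin.cons (-∑ k, b k) b
      map_add' := fun b b' => by
        ext j
        refine Fin.cases ?_ (fun k => ?_) j
        · simp [Finset.sum_add_distrib, add_comm]
        · simp
      map_smul' := fun r b => by
        ext j
        refine Fin.cases ?_ (fun k => ?_) j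
        · simp [Finset.mul_sum]
        · simp }
  have hT0 : ∀ b, ∑ j, T b j = 0 := fun b => by simp [T, Fin.sum_univ_succ]
  have hTk : ∀ b (k : Fin m), T b k.succ = b k := fun b k => by simp [T]
  set B := chiSqForm (gridPoint m) (gridWeight_pos hm)
  obtain ⟨b, hb⟩ := exists_orthonormal_of_posDef (B.comp T T)
    (fun x y => chiSqForm_comm (gridWeight_pos hm) _ _)
    (fun x => chiSqForm_self_nonneg (gridWeight_pos hm) _) (fun x hx => by
      ext k
      -- The same weight bound gives definiteness: norm zero forces every weight to vanish.
      have h := abs_le_mul_sqrt_chiSqForm hm (T x) k.succ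
      rw [show chiSqForm (gridPoint m) (gridWeight_pos hm) (T x) (T x) = 0 from hx, hTk] at h
      simpa using h)
  have hdim : Module.finrank ℝ (Fin m → ℝ) = m := by simp
  refine ⟨fun k => T (b (Fin.cast hdim.symm k)), fun k => hT0 _, fun k j => ?_, fun k l => ?_⟩
  · have h := abs_le_mul_sqrt_chiSqForm hm (T (b (Fin.cast hdim.symm k))) j
    have h1 := hb (Fin.cast hdim.symm k) (Fin.cast hdim.symm k)
    rw [if_pos rfl] at h1
    rw [show chiSqForm (gridPoint m) (gridWeight_pos hm) (T (b (Fin.cast hdim.symm k)))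
      (T (b (Fin.cast hdim.symm k))) = 1 from h1] at h
    simpa using h
  · have h := hb (Fin.cast hdim.symm k) (Fin.cast hdim.symm l)
    simp only [Fin.cast_inj] at h
    exact h

/-! ### Product laws and indistinguishability -/

theorem lintegral_fin_prod_eq_prod {n : ℕ} {E : Fin n → Type*} {mE : ∀ i, MeasurableSpace (E i)}
    {μ : (i : Fin n) → Measure (E i)} [∀ i, SigmaFinite (μ i)] {f : (i : Fin n) → E i → ℝ≥0∞}
    (hf : ∀ i, Measurable (f i)) :
    ∫⁻ x : (i : Fin n) → E i, ∏ i, f i (x i) ∂(Measure.pi μ) = ∏ i, ∫⁻ x, f i x ∂(μ i) := by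
  induction n with
  | zero => simp
  | succ n ih =>
    have hmeas : Measurable fun x : (i : Fin n) → E i.succ => ∏ i, f i.succ (x i) :=
      Finset.measurable_prod _ fun i _ => (hf _).comp (measurable_pi_apply i)
    have hmeas' : Measurable fun x : (i : Fin (n + 1)) → E i => ∏ i, f i (x i) :=
      Finset.measurable_prod _ fun i _ => (hf i).comp (measurable_pi_apply i)
    rw [Fin.prod_univ_succ, ← ih (fun i => hf i.succ), ← lintegral_prod_mul (hf 0).aemeasurable
      hmeas.aemeasurable, ← (measurePreserving_piFinSuccAbove μ 0).symm.lintegral_comp hmeas']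
    refine lintegral_congr fun x => ?_
    rw [Fin.prod_univ_succ]
    rfl

variable {d n : ℕ}

theorem iidLaw_eq_withDensity {f : EuclideanSpace ℝ (Fin d) → ℝ} (hf : Measurable f) :
    iidLaw n f = (volume : Measure (Fin n → EuclideanSpace ℝ (Fin d))).withDensity
      fun X => ∏ i, ENNReal.ofReal (f (X i)) := by
  have hof : Measurable fun x => ENNReal.ofReal (f x) := hf.ennreal_ofReal
  refine Measure.pi_eq fun s hs => ?_
  rw [withDensity_apply _ (MeasurableSet.univ_pi hs), ← lintegral_indicator
    (MeasurableSet.univ_pi hs)]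
  have : ∀ X : Fin n → EuclideanSpace ℝ (Fin d),
      (Set.univ.pi s).indicator (fun X => ∏ i, ENNReal.ofReal (f (X i))) X =
        ∏ i, (s i).indicator (fun x => ENNReal.ofReal (f x)) (X i) := by
    intro X
    by_cases hX : X ∈ Set.univ.pi s
    · rw [Set.indicator_of_mem hX]
      exact Finset.prod_congr rfl fun i _ =>
        (Set.indicator_of_mem (hX i (Set.mem_univ i)) fun x => ENNReal.ofReal (f x)).symm
    · rw [Set.indicator_of_notMem hX]
      simp only [Set.mem_univ_pi, not_forall] at hX
      obtain ⟨i, hi⟩ := hX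
      exact (Finset.prod_eq_zero (Finset.mem_univ i) (Set.indicator_of_notMem hi _)).symm
  simp_rw [this]
  rw [volume_pi, lintegral_fin_prod_eq_prod fun i => hof.indicator (hs i)]
  exact Finset.prod_congr rfl fun i _ => by
    rw [lintegral_indicator (hs i), withDensity_apply _ (hs i)]

/-- Le Cam's inequality between the Hellinger affinity and the testing affinity. -/
theorem sq_lintegral_le_two_mul_lintegral_min {α : Type*} [MeasurableSpace α] {μ : Measure α}
    {p q r : α → ℝ≥0∞} (hp : Measurable p) (hq : Measurable q) (hp1 : ∫⁻ x, p x ∂μ = 1)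
    (hq1 : ∫⁻ x, q x ∂μ = 1) (hr : ∀ x, r x ^ 2 = p x * q x) :
    (∫⁻ x, r x ∂μ) ^ 2 ≤ 2 * ∫⁻ x, min (p x) (q x) ∂μ := by
  have hhalf : ∀ y : ℝ≥0∞, (y ^ (1 / 2 : ℝ)) ^ (2 : ℝ) = y := fun y => by
    rw [← ENNReal.rpow_mul]; norm_num
  have hhalf' : ∀ y : ℝ≥0∞, (y ^ (1 / 2 : ℝ)) ^ 2 = y := fun y => by
    rw [← ENNReal.rpow_two, hhalf]
  -- Since `p q = min p q * max p q`, Cauchy–Schwarz applies to the square roots of the two factors;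
  -- the maximum integrates to at most 2.
  have hr' : ∀ x, r x = (min (p x) (q x)) ^ (1 / 2 : ℝ) * (max (p x) (q x)) ^ (1 / 2 : ℝ) := by
    intro x
    rw [← ENNReal.mul_rpow_of_nonneg _ _ (by norm_num), min_mul_max, ← hr, ← ENNReal.rpow_two,
      ← ENNReal.rpow_mul]
    norm_num
  have hmin : Measurable fun x => (min (p x) (q x)) ^ (1 / 2 : ℝ) := (hp.min hq).pow_const _
  have hmax : Measurable fun x => (max (p x) (q x)) ^ (1 / 2 : ℝ) := (hp.max hq).pow_const _
  have h := ENNReal.lintegral_mul_le_Lp_mul_Lq μ Real.HolderConjugate.two_two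
    hmin.aemeasurable hmax.aemeasurable
  simp only [Pi.mul_apply, hhalf, ← hr'] at h
  have hmax2 : ∫⁻ x, max (p x) (q x) ∂μ ≤ 2 := by
    calc ∫⁻ x, max (p x) (q x) ∂μ ≤ ∫⁻ x, (p x + q x) ∂μ :=
          lintegral_mono fun x => max_le le_self_add le_add_self
      _ = 2 := by rw [lintegral_add_left hp, hp1, hq1]; norm_num
  calc (∫⁻ x, r x ∂μ) ^ 2 ≤ _ := pow_le_pow_left' h 2
    _ = (∫⁻ x, min (p x) (q x) ∂μ) * ∫⁻ x, max (p x) (q x) ∂μ := by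
        rw [mul_pow, hhalf', hhalf']
    _ ≤ _ := by rw [mul_comm]; gcongr

/-- Two product laws whose marginals are within squared Hellinger distance `1 / n` cannot be
distinguished. -/
theorem one_eighth_le_lintegral_min (hn : 0 < n) {f g : EuclideanSpace ℝ (Fin d) → ℝ}
    (hf : Measurable f) (hg : Measurable g) (hf0 : ∀ x, 0 ≤ f x) (hg0 : ∀ x, 0 ≤ g x)
    (hf1 : ∫⁻ x, ENNReal.ofReal (f x) = 1) (hg1 : ∫⁻ x, ENNReal.ofReal (g x) = 1)
    (hfg : hellingerSq f g ≤ ENNReal.ofReal (1 / n)) :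
    ENNReal.ofReal (1 / 8) ≤ ∫⁻ X : Fin n → EuclideanSpace ℝ (Fin d),
      min (∏ i, ENNReal.ofReal (f (X i))) (∏ i, ENNReal.ofReal (g (X i))) := by
  have hn1 : (1 : ℝ) ≤ n := by exact_mod_cast hn
  set A := ∫⁻ x, ENNReal.ofReal (√(f x) * √(g x)) with hA
  have hAmeas : Measurable fun x => ENNReal.ofReal (√(f x) * √(g x)) :=
    (hf.sqrt.mul hg.sqrt).ennreal_ofReal
  have hsum : (2 : ℝ≥0∞) = hellingerSq f g + 2 * A := by
    rw [hellingerSq, hA, ← lintegral_const_mul _ hAmeas, ← lintegral_add_right _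
      (hAmeas.const_mul _)]
    have : ∀ x, ENNReal.ofReal ((√(f x) - √(g x)) ^ 2) + 2 * ENNReal.ofReal (√(f x) * √(g x)) =
        ENNReal.ofReal (f x) + ENNReal.ofReal (g x) := by
      intro x
      rw [← ENNReal.ofReal_add (hf0 x) (hg0 x), ← ENNReal.ofReal_ofNat 2,
        ← ENNReal.ofReal_mul (by norm_num), ← ENNReal.ofReal_add (by positivity) (by positivity)]
      congr 1
      nlinarith [Real.sq_sqrt (hf0 x), Real.sq_sqrt (hg0 x)]
    simp_rw [this]
    rw [lintegral_add_left hf.ennreal_ofReal, hf1, hg1]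
    norm_num
  have hAlow : ENNReal.ofReal (1 - 1 / (2 * n)) ≤ A := by
    by_cases hAtop : A = ∞
    · simp [hAtop]
    have h1 : (2 : ℝ≥0∞) ≤ ENNReal.ofReal (1 / n + 2 * A.toReal) := by
      rw [ENNReal.ofReal_add (by positivity) (by positivity), ENNReal.ofReal_mul (by norm_num),
        ENNReal.ofReal_toReal hAtop, ENNReal.ofReal_ofNat]
      nth_rewrite 1 [hsum]
      gcongr
    rw [← ENNReal.ofReal_ofNat 2, ENNReal.ofReal_le_ofReal_iff (by positivity)] at h1
    refine ENNReal.ofReal_le_of_le_toReal ?_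
    have : (1 : ℝ) / (2 * n) = 1 / n / 2 := by field_simp
    linarith
  have hprod := sq_lintegral_le_two_mul_lintegral_min
    (μ := (volume : Measure (Fin n → EuclideanSpace ℝ (Fin d))))
    (p := fun X => ∏ i, ENNReal.ofReal (f (X i))) (q := fun X => ∏ i, ENNReal.ofReal (g (X i)))
    (r := fun X => ∏ i, ENNReal.ofReal (√(f (X i)) * √(g (X i))))
    (Finset.measurable_prod _ fun i _ => hf.ennreal_ofReal.comp (measurable_pi_apply i))
    (Finset.measurable_prod _ fun i _ => hg.ennreal_ofReal.comp (measurable_pi_apply i))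
    (by rw [volume_pi, lintegral_fin_prod_eq_prod fun _ => hf.ennreal_ofReal]; simp [hf1])
    (by rw [volume_pi, lintegral_fin_prod_eq_prod fun _ => hg.ennreal_ofReal]; simp [hg1])
    (fun X => by
      rw [← Finset.prod_pow, ← Finset.prod_mul_distrib]
      refine Finset.prod_congr rfl fun i _ => ?_
      rw [← ENNReal.ofReal_mul (hf0 _), ← ENNReal.ofReal_pow (by positivity), mul_pow,
        Real.sq_sqrt (hf0 _), Real.sq_sqrt (hg0 _)])
  rw [volume_pi, lintegral_fin_prod_eq_prod fun _ => hAmeas] at hprod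
  simp only [Finset.prod_const, Finset.card_univ, Fintype.card_fin] at hprod
  -- The affinity tensorises, and Bernoulli's inequality keeps its `n`-th power above 1/2.
  have hbern : (1 / 2 : ℝ) ≤ (1 - 1 / (2 * n)) ^ n := by
    have h := one_add_mul_le_pow (a := -(1 / (2 * n) : ℝ)) (by
      have : (1 : ℝ) / (2 * n) ≤ 1 := by rw [div_le_one (by positivity)]; linarith
      linarith) n
    rw [← sub_eq_add_neg] at h
    refine le_trans (le_of_eq ?_) h
    field_simp
    norm_num
  have hpos : (0 : ℝ) ≤ 1 - 1 / (2 * n) := by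
    have : (1 : ℝ) / (2 * n) ≤ 1 := by rw [div_le_one (by positivity)]; linarith
    linarith
  have h4 : ENNReal.ofReal (1 / 4) ≤ (A ^ n) ^ 2 := by
    calc ENNReal.ofReal (1 / 4) ≤ ENNReal.ofReal (((1 - 1 / (2 * n)) ^ n) ^ 2) := by
          apply ENNReal.ofReal_le_ofReal; nlinarith
      _ = (ENNReal.ofReal (1 - 1 / (2 * n)) ^ n) ^ 2 := by
          rw [ENNReal.ofReal_pow (by positivity), ENNReal.ofReal_pow hpos]
      _ ≤ _ := by gcongr
  have h5 := h4.trans hprod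
  rw [volume_pi]
  rw [show (1 / 4 : ℝ) = 2 * (1 / 8) by norm_num, ENNReal.ofReal_mul (by norm_num),
    ENNReal.ofReal_ofNat] at h5
  exact (ENNReal.mul_le_mul_iff_right (by norm_num) (by norm_num)).1 h5

theorem hellingerSq_comm (f g : EuclideanSpace ℝ (Fin d) → ℝ) :
    hellingerSq f g = hellingerSq g f := by
  unfold hellingerSq
  congr 1 with x
  congr 1
  ring

theorem hellingerSq_le_two_mul_add {f g k : EuclideanSpace ℝ (Fin d) → ℝ}
    (hf : Measurable f) (hg : Measurable g) :
    hellingerSq f k ≤ 2 * (hellingerSq f g + hellingerSq g k) := by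
  have hm : Measurable fun x => ENNReal.ofReal ((√(f x) - √(g x)) ^ 2) :=
    ((hf.sqrt.sub hg.sqrt).pow_const 2).ennreal_ofReal
  unfold hellingerSq
  rw [← lintegral_add_left hm, ← lintegral_const_mul' _ _ (by norm_num)]
  refine lintegral_mono fun x => ?_
  rw [← ENNReal.ofReal_add (by positivity) (by positivity), ← ENNReal.ofReal_ofNat 2,
    ← ENNReal.ofReal_mul (by norm_num)]
  apply ENNReal.ofReal_le_ofReal
  nlinarith [sq_nonneg (√(f x) - √(g x) - (√(g x) - √(k x)))]

/-! ### Assouad's lemma -/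

/-- Flip one coordinate of a vertex of the hypercube. -/
def flipAt {κ : Type*} [DecidableEq κ] (k : κ) (τ : κ → Bool) : κ → Bool :=
  Function.update τ k (!τ k)

theorem flipAt_involutive {κ : Type*} [DecidableEq κ] (k : κ) :
    Function.Involutive (flipAt k) := by
  intro τ
  simp [flipAt]

/-- Summing over the hypercube, any guess of the vertex errs in each coordinate with at least the
overlap of neighbouring weights. -/
theorem sum_min_flipAt_le {κ : Type*} [Fintype κ] [DecidableEq κ] (p : (κ → Bool) → ℝ≥0∞)
    (σ : κ → Bool) :
    ∑ k, ∑ τ, min (p τ) (p (flipAt k τ)) ≤ 2 * ∑ τ, p τ * (hammingDist σ τ : ℝ≥0∞) := by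
  have hham : ∀ τ, (hammingDist σ τ : ℝ≥0∞) = ∑ k, if σ k ≠ τ k then 1 else 0 := by
    intro τ
    rw [hammingDist, Finset.card_filter]
    push_cast
    rfl
  simp_rw [hham, Finset.mul_sum (s := Finset.univ (α := κ))]
  rw [Finset.sum_comm (s := Finset.univ (α := κ → Bool)), Finset.mul_sum]
  refine Finset.sum_le_sum fun k _ => ?_
  set g : (κ → Bool) → ℝ≥0∞ := fun τ => p τ * if σ k ≠ τ k then 1 else 0 with hg
  have h1 : ∑ τ, g τ = ∑ τ, g (flipAt k τ) :=
    (Equiv.sum_comp (flipAt_involutive k).toPerm g).symm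
  rw [two_mul]
  nth_rewrite 2 [h1]
  rw [← Finset.sum_add_distrib]
  refine Finset.sum_le_sum fun τ _ => ?_
  -- Exactly one of `τ` and its flip disagrees with `σ` at `k`; its weight is at least the minimum.
  by_cases h : σ k = τ k
  · have : σ k ≠ flipAt k τ k := by simp [flipAt, h]
    simp [hg, this]
  · simp [hg, h]

/-- **Assouad's lemma** for the squared Hellinger loss. -/
theorem assouad_hellinger {κ : Type*} [Fintype κ] [DecidableEq κ] (hn : 0 < n)
    {ℱ : Set (EuclideanSpace ℝ (Fin d) → ℝ)} (f : (κ → Bool) → EuclideanSpace ℝ (Fin d) → ℝ)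
    (hmem : ∀ τ, f τ ∈ ℱ) (hmeas : ∀ τ, Measurable (f τ)) (hnonneg : ∀ τ x, 0 ≤ f τ x)
    (hone : ∀ τ, ∫⁻ x, ENNReal.ofReal (f τ x) = 1) (η : ℝ≥0∞)
    (hsep : ∀ τ τ', hammingDist τ τ' * η ≤ hellingerSq (f τ) (f τ'))
    (hclose : ∀ τ k, hellingerSq (f τ) (f (flipAt k τ)) ≤ ENNReal.ofReal (1 / n)) :
    Fintype.card κ * η / 64 ≤ minimaxHellingerRisk n ℱ := by
  refine le_iInf fun fhat => ?_
  set D : (κ → Bool) → (Fin n → EuclideanSpace ℝ (Fin d)) → ℝ≥0∞ :=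
    fun τ X => hellingerSq (fhat.toFun X) (f τ) with hD
  set p : (κ → Bool) → (Fin n → EuclideanSpace ℝ (Fin d)) → ℝ≥0∞ :=
    fun τ X => ∏ i, ENNReal.ofReal (f τ (X i)) with hp
  have hDmeas : ∀ τ, Measurable (D τ) := fun τ => by
    have h : Measurable fun z : (Fin n → EuclideanSpace ℝ (Fin d)) × EuclideanSpace ℝ (Fin d) =>
        ENNReal.ofReal ((√(fhat.toFun z.1 z.2) - √(f τ z.2)) ^ 2) :=
      ((fhat.measurable.sqrt.sub ((hmeas τ).comp measurable_snd).sqrt).pow_const 2).ennreal_ofReal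
    exact h.lintegral_prod_right'
  have hpmeas : ∀ τ, Measurable (p τ) := fun τ =>
    Finset.measurable_prod _ fun i _ => (hmeas τ).ennreal_ofReal.comp (measurable_pi_apply i)
  have hfX : ∀ X, Measurable (fhat.toFun X) := fun X =>
    fhat.measurable.comp measurable_prodMk_left
  set R := ⨆ f ∈ ℱ, ∫⁻ X, hellingerSq (fhat.toFun X) f ∂(iidLaw n f) with hR
  have hle : ∀ τ, ∫⁻ X, p τ X * D τ X ≤ R := by
    intro τ
    refine le_trans (le_of_eq ?_) (le_iSup₂ (f := fun f (_ : f ∈ ℱ) =>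
      ∫⁻ X, hellingerSq (fhat.toFun X) f ∂(iidLaw n f)) (f τ) (hmem τ))
    rw [iidLaw_eq_withDensity (hmeas τ),
      lintegral_withDensity_eq_lintegral_mul _ (hpmeas τ) (hDmeas τ)]
    rfl
  have hpoint : ∀ X, η * ∑ k, ∑ τ, min (p τ X) (p (flipAt k τ) X) ≤ 8 * ∑ τ, p τ X * D τ X := by
    intro X
    -- The estimate is replaced by a nearest vertex. The argument is pointwise in the sample, so no
    -- measurable selection is needed.
    obtain ⟨σ, -, hσ⟩ := Finset.exists_min_image Finset.univ (fun τ => D τ X)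
      Finset.univ_nonempty
    have hDσ : ∀ τ, hammingDist σ τ * η ≤ 4 * D τ X := by
      intro τ
      refine (hsep σ τ).trans ((hellingerSq_le_two_mul_add (hmeas σ) (hfX X)).trans ?_)
      rw [hellingerSq_comm (f σ)]
      calc 2 * (D σ X + D τ X) ≤ 2 * (D τ X + D τ X) := by
            gcongr; exact hσ τ (Finset.mem_univ τ)
        _ = 4 * D τ X := by rw [← two_mul, ← mul_assoc]; norm_num
    calc η * ∑ k, ∑ τ, min (p τ X) (p (flipAt k τ) X)
        ≤ η * (2 * ∑ τ, p τ X * (hammingDist σ τ : ℝ≥0∞)) := by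
          gcongr; exact sum_min_flipAt_le (fun τ => p τ X) σ
      _ = 2 * ∑ τ, p τ X * (hammingDist σ τ * η) := by
          rw [Finset.mul_sum, Finset.mul_sum, Finset.mul_sum]
          exact Finset.sum_congr rfl fun τ _ => by ring
      _ ≤ 2 * ∑ τ, p τ X * (4 * D τ X) := by
          gcongr 2 * ∑ τ, p τ X * ?_ with τ; exact hDσ τ
      _ = 8 * ∑ τ, p τ X * D τ X := by
          rw [Finset.mul_sum, Finset.mul_sum]
          exact Finset.sum_congr rfl fun τ _ => by ring
  have hminmeas : ∀ k τ, Measurable fun X => min (p τ X) (p (flipAt k τ) X) := fun k τ =>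
    (hpmeas τ).min (hpmeas _)
  have hsum1 : ∫⁻ X, η * ∑ k, ∑ τ, min (p τ X) (p (flipAt k τ) X) =
      η * ∑ k, ∑ τ, ∫⁻ X, min (p τ X) (p (flipAt k τ) X) := by
    rw [lintegral_const_mul _ (Finset.measurable_fun_sum _ fun k _ =>
      Finset.measurable_fun_sum _ fun τ _ => hminmeas k τ),
      lintegral_finsetSum _ fun k _ => Finset.measurable_fun_sum _ fun τ _ => hminmeas k τ]
    congr 1
    exact Finset.sum_congr rfl fun k _ => lintegral_finsetSum _ fun τ _ => hminmeas k τ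
  have hsum2 : ∫⁻ X, 8 * ∑ τ, p τ X * D τ X = 8 * ∑ τ, ∫⁻ X, p τ X * D τ X := by
    have h : ∀ τ, Measurable fun X => p τ X * D τ X := fun τ => (hpmeas τ).mul (hDmeas τ)
    rw [lintegral_const_mul _ (Finset.measurable_fun_sum _ fun τ _ => h τ),
      lintegral_finsetSum _ fun τ _ => h τ]
  have hmain : η * ∑ _k : κ, ∑ _τ : κ → Bool, ENNReal.ofReal (1 / 8) ≤
      8 * ∑ _τ : κ → Bool, R := by
    calc η * ∑ _k : κ, ∑ _τ : κ → Bool, ENNReal.ofReal (1 / 8)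
        ≤ η * ∑ k, ∑ τ, ∫⁻ X, min (p τ X) (p (flipAt k τ) X) := by
          gcongr with k _ τ _
          exact one_eighth_le_lintegral_min hn (hmeas τ) (hmeas _) (hnonneg τ) (hnonneg _)
            (hone τ) (hone _) (hclose τ k)
      _ ≤ 8 * ∑ τ, ∫⁻ X, p τ X * D τ X := by
          rw [← hsum1, ← hsum2]; exact lintegral_mono hpoint
      _ ≤ _ := by gcongr with τ; exact hle τ
  simp only [Finset.sum_const, Finset.card_univ, nsmul_eq_mul] at hmain
  set N : ℝ≥0∞ := (Fintype.card (κ → Bool) : ℝ≥0∞) with hN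
  have hN0 : N ≠ 0 := by simp [hN]
  have hNtop : N ≠ ∞ := ENNReal.natCast_ne_top _
  have h8 : ENNReal.ofReal (1 / 8) * 8 = 1 := by
    rw [← ENNReal.ofReal_ofNat 8, ← ENNReal.ofReal_mul (by norm_num)]; norm_num
  rw [ENNReal.div_le_iff (by norm_num) (by norm_num)]
  -- The supremum risk dominates the average over vertices, so their number cancels. The 64 combines
  -- the 8 of the pointwise bound with the overlap 1/8.
  refine (ENNReal.mul_le_mul_iff_right hN0 hNtop).1 ?_
  calc N * (Fintype.card κ * η)
      = (η * (Fintype.card κ * (N * ENNReal.ofReal (1 / 8)))) * 8 := by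
        calc _ = N * (Fintype.card κ * η) * (ENNReal.ofReal (1 / 8) * 8) := by rw [h8, mul_one]
          _ = _ := by ring
    _ ≤ (8 * (N * R)) * 8 := by gcongr
    _ = N * (R * 64) := by ring

/-! ### Tensor products and mixing measures in dimension `d` -/

variable {m : ℕ}

theorem integral_euclidean_prod (g : Fin d → ℝ → ℝ) :
    ∫ x : EuclideanSpace ℝ (Fin d), ∏ i, g i (x i) = ∏ i, ∫ y, g i y := by
  rw [← integral_fintype_prod_volume_eq_prod g]
  exact (PiLp.volume_preserving_ofLp (Fin d)).integral_comp
    (MeasurableEquiv.toLp 2 (Fin d → ℝ)).symm.measurableEmbedding fun y => ∏ i, g i (y i)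

theorem integrable_euclidean_prod {g : Fin d → ℝ → ℝ} (hg : ∀ i, Integrable (g i)) :
    Integrable fun x : EuclideanSpace ℝ (Fin d) => ∏ i, g i (x i) :=
  ((PiLp.volume_preserving_ofLp (Fin d)).integrable_comp_emb
    (MeasurableEquiv.toLp 2 (Fin d → ℝ)).symm.measurableEmbedding).2
    (Integrable.fintype_prod hg)

/-- The product function `x ↦ ∏ i, gaussianSum (gridPoint m) (w i) (x i)`. -/
noncomputable def gridTensor (w : Fin d → Fin (m + 1) → ℝ) (x : EuclideanSpace ℝ (Fin d)) : ℝ :=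
  ∏ i, gaussianSum (gridPoint m) (w i) (x i)

/-- The product density that serves as the centre of the hypercube. -/
noncomputable def gridBase (d m : ℕ) : EuclideanSpace ℝ (Fin d) → ℝ :=
  gridTensor fun _ => gridWeight m

theorem gridTensor_eq_sum (w : Fin d → Fin (m + 1) → ℝ) (x : EuclideanSpace ℝ (Fin d)) :
    gridTensor w x = ∑ J : Fin d → Fin (m + 1),
      (∏ i, w i (J i)) * ∏ i, gaussianPDFReal 0 1 (x i - gridPoint m (J i)) := by
  simp only [gridTensor, gaussianSum, Finset.prod_univ_sum, Fintype.piFinset_univ,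
    Finset.prod_mul_distrib]

theorem continuous_gridTensor (w : Fin d → Fin (m + 1) → ℝ) : Continuous (gridTensor w) :=
  continuous_finsetProd _ fun i _ => (continuous_gaussianSum _ (w i)).comp (by fun_prop)

theorem integrable_gridTensor (w : Fin d → Fin (m + 1) → ℝ) : Integrable (gridTensor w) :=
  integrable_euclidean_prod fun i => integrable_gaussianSum _ (w i)

theorem integral_gridTensor (w : Fin d → Fin (m + 1) → ℝ) :
    ∫ x, gridTensor w x = ∏ i, ∑ j, w i j := by
  simp only [gridTensor]
  rw [integral_euclidean_prod fun i => gaussianSum (gridPoint m) (w i)]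
  simp only [integral_gaussianSum]

theorem gridBase_pos (hm : 1 ≤ m) (x : EuclideanSpace ℝ (Fin d)) : 0 < gridBase d m x := by
  unfold gridBase gridTensor
  exact Finset.prod_pos fun _ _ => gaussianSum_pos (gridWeight_pos hm) _

theorem gridTensor_mul_div_eq (w w' : Fin d → Fin (m + 1) → ℝ) (x : EuclideanSpace ℝ (Fin d)) :
    gridTensor w x * gridTensor w' x / gridBase d m x =
      ∏ i, gaussianSum (gridPoint m) (w i) (x i) * gaussianSum (gridPoint m) (w' i) (x i) /
        gaussianSum (gridPoint m) (gridWeight m) (x i) := by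
  simp only [gridTensor, gridBase, Finset.prod_div_distrib, Finset.prod_mul_distrib]

theorem integrable_gridTensor_mul_div (hm : 1 ≤ m) (w w' : Fin d → Fin (m + 1) → ℝ) :
    Integrable fun x => gridTensor w x * gridTensor w' x / gridBase d m x := by
  simp_rw [gridTensor_mul_div_eq]
  exact integrable_euclidean_prod fun i =>
    integrable_gaussianSum_mul_div (gridWeight_pos hm) (w i) (w' i)

theorem integral_gridTensor_mul_div (w w' : Fin d → Fin (m + 1) → ℝ) :
    ∫ x, gridTensor w x * gridTensor w' x / gridBase d m x =
      ∏ i, ∫ y, gaussianSum (gridPoint m) (w i) y * gaussianSum (gridPoint m) (w' i) y /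
        gaussianSum (gridPoint m) (gridWeight m) y := by
  simp_rw [gridTensor_mul_div_eq]
  exact integral_euclidean_prod fun i y => gaussianSum (gridPoint m) (w i) y *
    gaussianSum (gridPoint m) (w' i) y / gaussianSum (gridPoint m) (gridWeight m) y

/-- The tensor perturbation with coefficients `s` built from the system `c`. -/
noncomputable def perturbation (c : Fin m → Fin (m + 1) → ℝ) (s : (Fin d → Fin m) → ℝ)
    (x : EuclideanSpace ℝ (Fin d)) : ℝ :=
  ∑ κ, s κ * gridTensor (fun i => c (κ i)) x

theorem sq_perturbation_div_eq (c : Fin m → Fin (m + 1) → ℝ) (s : (Fin d → Fin m) → ℝ)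
    (x : EuclideanSpace ℝ (Fin d)) :
    perturbation c s x ^ 2 / gridBase d m x = ∑ κ, ∑ l, s κ * s l *
      (gridTensor (fun i => c (κ i)) x * gridTensor (fun i => c (l i)) x / gridBase d m x) := by
  rw [sq, perturbation, Finset.sum_mul_sum, Finset.sum_div]
  refine Finset.sum_congr rfl fun κ _ => ?_
  rw [Finset.sum_div]
  exact Finset.sum_congr rfl fun l _ => by ring

theorem integrable_sq_perturbation_div (hm : 1 ≤ m) (c : Fin m → Fin (m + 1) → ℝ)
    (s : (Fin d → Fin m) → ℝ) :
    Integrable fun x => perturbation c s x ^ 2 / gridBase d m x := by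
  simp_rw [sq_perturbation_div_eq]
  exact integrable_finsetSum _ fun κ _ => integrable_finsetSum _ fun l _ =>
    (integrable_gridTensor_mul_div hm _ _).const_mul _

/-- Inner products of tensors factor over the coordinates, so one differing index kills every
off-diagonal term. -/
theorem integral_sq_perturbation_div (hm : 1 ≤ m) {c : Fin m → Fin (m + 1) → ℝ}
    (hc : ∀ k l, ∫ x, gaussianSum (gridPoint m) (c k) x * gaussianSum (gridPoint m) (c l) x /
        gaussianSum (gridPoint m) (gridWeight m) x = if k = l then 1 else 0)
    (s : (Fin d → Fin m) → ℝ) :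
    ∫ x, perturbation c s x ^ 2 / gridBase d m x = ∑ κ, s κ ^ 2 := by
  simp_rw [sq_perturbation_div_eq]
  rw [integral_finsetSum _ fun κ _ => integrable_finsetSum _ fun l _ =>
    (integrable_gridTensor_mul_div hm _ _).const_mul _]
  refine Finset.sum_congr rfl fun κ _ => ?_
  rw [integral_finsetSum _ fun l _ => (integrable_gridTensor_mul_div hm _ _).const_mul _,
    Finset.sum_eq_single κ]
  · rw [integral_const_mul, integral_gridTensor_mul_div]
    simp [hc, sq]
  · intro l _ hl
    rw [integral_const_mul, integral_gridTensor_mul_div]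
    obtain ⟨i, hi⟩ := Function.ne_iff.1 hl.symm
    rw [Finset.prod_eq_zero (Finset.mem_univ i), mul_zero]
    rw [hc, if_neg hi]
  · simp

/-- The weight at the grid point with multi-index `J` of the mixing measure with perturbation `s`. -/
noncomputable def mixingWeight (c : Fin m → Fin (m + 1) → ℝ) (s : (Fin d → Fin m) → ℝ)
    (J : Fin d → Fin (m + 1)) : ℝ :=
  ∏ i, gridWeight m (J i) + ∑ κ, s κ * ∏ i, c (κ i) (J i)

/-- The discrete measure on the grid with weights `w`. -/
noncomputable def gridMeasure (w : (Fin d → Fin (m + 1)) → ℝ) :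
    Measure (EuclideanSpace ℝ (Fin d)) :=
  ∑ J, ENNReal.ofReal (w J) • Measure.dirac (WithLp.toLp 2 fun i => gridPoint m (J i))

theorem mixtureDensity_gridMeasure {w : (Fin d → Fin (m + 1)) → ℝ} (hw : ∀ J, 0 ≤ w J)
    (x : EuclideanSpace ℝ (Fin d)) :
    mixtureDensity (gridMeasure w) x =
      ∑ J, w J * ∏ i, gaussianPDFReal 0 1 (x i - gridPoint m (J i)) := by
  rw [mixtureDensity, gridMeasure, integral_finsetSum_measure]
  · refine Finset.sum_congr rfl fun J _ => ?_
    rw [integral_smul_measure, integral_dirac, ENNReal.toReal_ofReal (hw J), smul_eq_mul]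
  · intro J _
    exact (integrable_dirac (by simp)).smul_measure ENNReal.ofReal_ne_top

theorem mixtureDensity_mixingWeight (c : Fin m → Fin (m + 1) → ℝ) {s : (Fin d → Fin m) → ℝ}
    (hw : ∀ J, 0 ≤ mixingWeight c s J) :
    mixtureDensity (gridMeasure (mixingWeight c s)) =
      fun x => gridBase d m x + perturbation c s x := by
  ext x
  rw [mixtureDensity_gridMeasure hw]
  simp only [mixingWeight, gridBase, perturbation, gridTensor_eq_sum, add_mul,
    Finset.sum_add_distrib, Finset.mul_sum, Finset.sum_mul, mul_assoc]
  rw [Finset.sum_comm]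

/-- A tensor's total mass is the product of its factors' masses, all zero; `1 ≤ d` excludes the
empty product. -/
theorem sum_mixingWeight (hd : 1 ≤ d) (hm : 1 ≤ m) {c : Fin m → Fin (m + 1) → ℝ}
    (hc : ∀ k, ∑ j, c k j = 0) (s : (Fin d → Fin m) → ℝ) : ∑ J, mixingWeight c s J = 1 := by
  have hprod : ∀ w : Fin d → Fin (m + 1) → ℝ,
      ∑ J : Fin d → Fin (m + 1), ∏ i, w i (J i) = ∏ i, ∑ j, w i j := fun w => by
    rw [Finset.prod_univ_sum, Fintype.piFinset_univ]
  simp only [mixingWeight, Finset.sum_add_distrib]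
  rw [Finset.sum_comm]
  simp only [← Finset.mul_sum]
  rw [hprod fun _ => gridWeight m]
  simp only [fun κ : Fin d → Fin m => hprod fun i => c (κ i), hc, sum_gridWeight hm,
    Finset.prod_const, Finset.card_univ, Fintype.card_fin, one_pow, zero_pow (by omega : d ≠ 0),
    mul_zero, Finset.sum_const_zero, add_zero]

/-- Small perturbations change each weight by at most a factor two. -/
theorem abs_sum_mul_prod_le {c : Fin m → Fin (m + 1) → ℝ} {K ε : ℝ}
    (hc : ∀ k j, |c k j| ≤ K * gridWeight m j) {s : (Fin d → Fin m) → ℝ} (hs : ∀ κ, |s κ| ≤ ε)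
    (hε : ε * (m * K) ^ d ≤ 1 / 2) (hm : 1 ≤ m) (J : Fin d → Fin (m + 1)) :
    |∑ κ, s κ * ∏ i, c (κ i) (J i)| ≤ (∏ i, gridWeight m (J i)) / 2 := by
  have hP : 0 < ∏ i, gridWeight m (J i) := Finset.prod_pos fun i _ => gridWeight_pos hm _
  have h1 : ∀ κ : Fin d → Fin m, |s κ * ∏ i, c (κ i) (J i)| ≤
      ε * (K ^ d * ∏ i, gridWeight m (J i)) := by
    intro κ
    rw [abs_mul, Finset.abs_prod]
    refine mul_le_mul (hs κ) ?_ (Finset.prod_nonneg fun i _ => abs_nonneg _)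
      ((abs_nonneg _).trans (hs κ))
    refine (Finset.prod_le_prod (fun i _ => abs_nonneg _) fun i _ => hc (κ i) (J i)).trans ?_
    rw [Finset.prod_mul_distrib]
    simp
  refine (Finset.abs_sum_le_sum_abs _ _).trans ((Finset.sum_le_sum fun κ _ => h1 κ).trans ?_)
  simp only [Finset.sum_const, Finset.card_univ, Fintype.card_fun, Fintype.card_fin, nsmul_eq_mul]
  push_cast
  calc (m : ℝ) ^ d * (ε * (K ^ d * ∏ i, gridWeight m (J i)))
      = (ε * (m * K) ^ d) * ∏ i, gridWeight m (J i) := by rw [mul_pow]; ring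
    _ ≤ 1 / 2 * ∏ i, gridWeight m (J i) := by gcongr
    _ = _ := by ring

/-- The support lies in the ball of squared radius `d m`, so only `t ^ 2 < d m` matters. There the
mass off the origin is at most `2 d exp (-m)` by Bernoulli, and `2 d ≤ Γ` gives `t ^ 2 / Γ ≤ m`. -/
theorem gridMeasure_mem_subGaussianMixing (hd : 1 ≤ d) (hm : 1 ≤ m) {Γ : ℝ} (hΓ : 2 * d ≤ Γ)
    {w : (Fin d → Fin (m + 1)) → ℝ} (hw0 : ∀ J, 0 ≤ w J) (hw1 : ∑ J, w J = 1)
    (hw2 : ∀ J, w J ≤ 2 * ∏ i, gridWeight m (J i)) :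
    gridMeasure w ∈ subGaussianMixing d Γ := by
  have hd1 : (1 : ℝ) ≤ d := by exact_mod_cast hd
  refine ⟨⟨?_⟩, fun t ht => ?_⟩
  · rw [gridMeasure, Measure.finsetSum_apply]
    simp only [Measure.smul_apply, measure_univ, smul_eq_mul, mul_one]
    rw [← ENNReal.ofReal_sum_of_nonneg fun J _ => hw0 J, hw1, ENNReal.ofReal_one]
  · have hmeas : MeasurableSet {u : EuclideanSpace ℝ (Fin d) | t < ‖u‖} :=
      measurableSet_lt measurable_const measurable_norm
    have hterm : ∀ J : Fin d → Fin (m + 1),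
        (ENNReal.ofReal (w J) • Measure.dirac
          (WithLp.toLp 2 fun i => gridPoint m (J i) : EuclideanSpace ℝ (Fin d)))
            {u | t < ‖u‖} ≤
        ENNReal.ofReal (if J = 0 then 0 else
          if t ^ 2 < d * m then 2 * ∏ i, gridWeight m (J i) else 0) := by
      intro J
      rw [Measure.smul_apply, Measure.dirac_apply' _ hmeas, smul_eq_mul]
      by_cases hJ : t < ‖(WithLp.toLp 2 fun i => gridPoint m (J i) : EuclideanSpace ℝ (Fin d))‖
      · rw [Set.indicator_of_mem (by exact hJ), Pi.one_apply, mul_one]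
        apply ENNReal.ofReal_le_ofReal
        rw [EuclideanSpace.norm_eq, Real.lt_sqrt ht.le] at hJ
        simp only [Real.norm_eq_abs, sq_abs] at hJ
        rw [if_neg, if_pos]
        · exact hw2 J
        · refine hJ.trans_le ((Finset.sum_le_sum fun i _ => gridPoint_sq_le hm (J i)).trans ?_)
          simp
        · rintro rfl
          simp only [Pi.zero_apply, gridPoint_zero] at hJ
          norm_num at hJ
          nlinarith
      · rw [Set.indicator_of_notMem (by exact hJ), mul_zero]
        exact zero_le
    have hnn : ∀ J : Fin d → Fin (m + 1), 0 ≤ (if J = 0 then 0 else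
          if t ^ 2 < d * m then 2 * ∏ i, gridWeight m (J i) else 0 : ℝ) := by
      intro J
      have : 0 < ∏ i, gridWeight m (J i) := Finset.prod_pos fun i _ => gridWeight_pos hm _
      split_ifs <;> positivity
    rw [gridMeasure, Measure.finsetSum_apply]
    refine (Finset.sum_le_sum fun J _ => hterm J).trans ?_
    rw [← ENNReal.ofReal_sum_of_nonneg fun J _ => hnn J]
    apply ENNReal.ofReal_le_ofReal
    have hΓ0 : 0 < Γ := by linarith
    by_cases htm : t ^ 2 < d * m
    · simp only [htm, if_true]
      have h1 : ∑ J : Fin d → Fin (m + 1), (if J = 0 then 0 else 2 * ∏ i, gridWeight m (J i)) =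
          2 * (1 - (1 - Real.exp (-m)) ^ d) := by
        have hall : ∑ J : Fin d → Fin (m + 1), ∏ i, gridWeight m (J i) = 1 := by
          have := Finset.prod_univ_sum (fun _ : Fin d => (Finset.univ : Finset (Fin (m + 1))))
            fun _ j => gridWeight m j
          rw [Fintype.piFinset_univ] at this
          rw [← this]
          simp [sum_gridWeight hm]
        have h0 : ∏ i : Fin d, gridWeight m ((0 : Fin d → Fin (m + 1)) i) =
            (1 - Real.exp (-m)) ^ d := by
          simp [gridWeight]
        rw [← h0, ← hall, ← Finset.sum_erase_eq_sub (Finset.mem_univ _), Finset.mul_sum,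
          ← Finset.sum_erase (a := (0 : Fin d → Fin (m + 1))) Finset.univ (by simp)]
        exact Finset.sum_congr rfl fun J hJ => by rw [if_neg (Finset.ne_of_mem_erase hJ)]
      rw [h1]
      have hb := one_add_mul_le_pow (a := -Real.exp (-m)) (by
        have : Real.exp (-m) ≤ 1 := Real.exp_le_one_iff.2 (by simp)
        linarith) d
      rw [← sub_eq_add_neg 1] at hb
      have hexp : Real.exp (-m) ≤ Real.exp (-t ^ 2 / Γ) := by
        apply Real.exp_le_exp.2
        rw [le_div_iff₀ hΓ0]
        have : (d : ℝ) * m ≤ Γ * m := by gcongr; linarith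
        linarith
      calc 2 * (1 - (1 - Real.exp (-m)) ^ d) ≤ 2 * d * Real.exp (-m) := by linarith
        _ ≤ Γ * Real.exp (-t ^ 2 / Γ) := by gcongr
    · simp only [htm, if_false, ite_self, Finset.sum_const_zero]
      positivity

/-! ### Hellinger geometry of the hypercube of mixtures -/

/-- Factor `f - g = (√f - √g) (√f + √g)`; the square of the last factor lies between `2 F` and `8
F`. This converts the weighted `L²` distance, where orthogonality is exact, to Hellinger. -/
theorem sq_sqrt_sub_sqrt_bounds {F f g : ℝ} (hF : 0 < F) (hf1 : F / 2 ≤ f) (hf2 : f ≤ 2 * F)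
    (hg1 : F / 2 ≤ g) (hg2 : g ≤ 2 * F) :
    1 / 8 * ((f - g) ^ 2 / F) ≤ (√f - √g) ^ 2 ∧ (√f - √g) ^ 2 ≤ 1 / 2 * ((f - g) ^ 2 / F) := by
  have hf := Real.sq_sqrt (show 0 ≤ f by linarith)
  have hg := Real.sq_sqrt (show 0 ≤ g by linarith)
  have hf0 := Real.sqrt_nonneg f
  have hg0 := Real.sqrt_nonneg g
  have hfg : (f - g) ^ 2 = (√f - √g) ^ 2 * (√f + √g) ^ 2 := by
    rw [← mul_pow, ← hf, ← hg]
    simp only [Real.sqrt_sq hf0, Real.sqrt_sq hg0]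
    ring
  have hup : (√f + √g) ^ 2 ≤ 8 * F := by nlinarith [sq_nonneg (√f - √g)]
  have hlow : 2 * F ≤ (√f + √g) ^ 2 := by
    have h1 : √(F / 2) ≤ √f := Real.sqrt_le_sqrt hf1
    have h2 : √(F / 2) ≤ √g := Real.sqrt_le_sqrt hg1
    have h3 := Real.sq_sqrt (show 0 ≤ F / 2 by linarith)
    have h4 := Real.sqrt_nonneg (F / 2)
    nlinarith
  have hsq := sq_nonneg (√f - √g)
  constructor
  · rw [← mul_div_assoc, div_le_iff₀ hF, hfg]
    nlinarith
  · rw [← mul_div_assoc, le_div_iff₀ hF, hfg]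
    nlinarith

/-- The minimax risk over the mixtures is at least that over a hypercube of dimension `m ^ d` whose
edges have length `ε`. -/
theorem le_minimaxHellingerRisk (hd : 1 ≤ d) (hm : 1 ≤ m) (hn : 0 < n) {Γ ε : ℝ}
    (hΓ : 2 * d ≤ Γ) (hε0 : 0 ≤ ε) (hε : ε * (m * 262144 ^ m) ^ d ≤ 1 / 2)
    (hεn : ε ^ 2 / 2 ≤ 1 / n) :
    ENNReal.ofReal (m ^ d * ε ^ 2 / 512) ≤
      minimaxHellingerRisk n (mixtureClass (subGaussianMixing d Γ)) := by
  obtain ⟨c, hc0, hcK, hcorth⟩ := exists_orthonormal_gaussianSum hm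
  -- With coefficients in `{0, ε}`, squared distance in `L²(1 / gridBase)` is exactly `ε ^ 2` times
  -- Hamming distance.
  let s : ((Fin d → Fin m) → Bool) → (Fin d → Fin m) → ℝ := fun τ κ => if τ κ then ε else 0
  have hs : ∀ τ κ, |s τ κ| ≤ ε := fun τ κ => by
    simp only [s]
    split_ifs <;> simp [abs_of_nonneg, hε0]
  have hpert : ∀ τ (J : Fin d → Fin (m + 1)),
      |∑ κ, s τ κ * ∏ i, c (κ i) (J i)| ≤ (∏ i, gridWeight m (J i)) / 2 := fun τ =>
    abs_sum_mul_prod_le hcK (hs τ) hε hm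
  have hP : ∀ J : Fin d → Fin (m + 1), 0 < ∏ i, gridWeight m (J i) := fun J =>
    Finset.prod_pos fun i _ => gridWeight_pos hm _
  have hw0 : ∀ τ (J : Fin d → Fin (m + 1)), 0 ≤ mixingWeight c (s τ) J := fun τ J => by
    rw [mixingWeight]
    linarith [(abs_le.1 (hpert τ J)).1, hP J]
  have hw2 : ∀ τ (J : Fin d → Fin (m + 1)),
      mixingWeight c (s τ) J ≤ 2 * ∏ i, gridWeight m (J i) := fun τ J => by
    rw [mixingWeight]
    linarith [(abs_le.1 (hpert τ J)).2, hP J]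
  let f : ((Fin d → Fin m) → Bool) → EuclideanSpace ℝ (Fin d) → ℝ := fun τ x =>
    gridBase d m x + perturbation c (s τ) x
  have hfabs : ∀ τ x, |perturbation c (s τ) x| ≤ gridBase d m x / 2 := by
    intro τ x
    simp only [perturbation, gridBase, gridTensor_eq_sum, Finset.mul_sum]
    rw [Finset.sum_comm, Finset.sum_div]
    refine (Finset.abs_sum_le_sum_abs _ _).trans (Finset.sum_le_sum fun J _ => ?_)
    simp only [← mul_assoc]
    rw [← Finset.sum_mul, abs_mul, mul_div_right_comm,
      abs_of_nonneg (Finset.prod_nonneg fun i _ => gaussianPDFReal_nonneg _ _ _)]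
    exact mul_le_mul_of_nonneg_right (hpert τ J)
      (Finset.prod_nonneg fun i _ => gaussianPDFReal_nonneg _ _ _)
  have hflow : ∀ τ x, gridBase d m x / 2 ≤ f τ x := fun τ x => by
    have := (abs_le.1 (hfabs τ x)).1
    simp only [f]
    linarith
  have hfup : ∀ τ x, f τ x ≤ 2 * gridBase d m x := fun τ x => by
    have := (abs_le.1 (hfabs τ x)).2
    have := gridBase_pos hm x
    simp only [f]
    linarith
  have hf0 : ∀ τ x, 0 ≤ f τ x := fun τ x => by
    linarith [hflow τ x, gridBase_pos hm x]
  have hpint : ∀ τ, Integrable (perturbation c (s τ)) := fun τ =>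
    integrable_finsetSum _ fun κ _ => (integrable_gridTensor _).const_mul _
  have hpzero : ∀ τ, ∫ x, perturbation c (s τ) x = 0 := fun τ => by
    simp only [perturbation]
    rw [integral_finsetSum _ fun κ _ => (integrable_gridTensor _).const_mul _]
    refine Finset.sum_eq_zero fun κ _ => ?_
    rw [integral_const_mul, integral_gridTensor]
    simp [hc0, show d ≠ 0 by omega]
  have hbint : Integrable (gridBase d m) := integrable_gridTensor _
  have hfone : ∀ τ, ∫⁻ x, ENNReal.ofReal (f τ x) = 1 := fun τ => by
    rw [← ofReal_integral_eq_lintegral_ofReal (f := f τ) (hbint.add (hpint τ))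
      (Filter.Eventually.of_forall (hf0 τ)), ← ENNReal.ofReal_one]
    congr 1
    simp only [f]
    rw [integral_add hbint (hpint τ), hpzero, gridBase, integral_gridTensor]
    simp [sum_gridWeight hm]
  have hfmeas : ∀ τ, Measurable (f τ) := fun τ =>
    ((continuous_gridTensor _).add (continuous_finsetSum _ fun κ _ =>
      continuous_const.mul (continuous_gridTensor _))).measurable
  have hfmem : ∀ τ, f τ ∈ mixtureClass (subGaussianMixing d Γ) := fun τ =>
    ⟨gridMeasure (mixingWeight c (s τ)), gridMeasure_mem_subGaussianMixing hd hm hΓ (hw0 τ)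
      (sum_mixingWeight hd hm hc0 _) (hw2 τ), mixtureDensity_mixingWeight c (hw0 τ)⟩
  have hdiff : ∀ τ τ' x, f τ x - f τ' x = perturbation c (fun κ => s τ κ - s τ' κ) x := by
    intro τ τ' x
    simp only [f, perturbation, sub_mul, Finset.sum_sub_distrib]
    ring
  have hsumsq : ∀ τ τ', ∑ κ, (s τ κ - s τ' κ) ^ 2 = hammingDist τ τ' * ε ^ 2 := by
    intro τ τ'
    rw [hammingDist, Finset.card_filter]
    push_cast
    rw [Finset.sum_mul]
    refine Finset.sum_congr rfl fun κ _ => ?_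
    simp only [s]
    cases τ κ <;> cases τ' κ <;> simp
  have hchi : ∀ (a : ℝ), 0 ≤ a → ∀ τ τ',
      ∫⁻ x, ENNReal.ofReal (a * ((f τ x - f τ' x) ^ 2 / gridBase d m x)) =
        ENNReal.ofReal (a * (hammingDist τ τ' * ε ^ 2)) := by
    intro a ha τ τ'
    simp only [hdiff]
    rw [← ofReal_integral_eq_lintegral_ofReal
      ((integrable_sq_perturbation_div hm c _).const_mul a)
      (Filter.Eventually.of_forall fun x =>
        mul_nonneg ha (div_nonneg (sq_nonneg _) (gridBase_pos hm x).le)),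
      integral_const_mul, integral_sq_perturbation_div hm hcorth, hsumsq]
  have hbounds := fun τ τ' x => sq_sqrt_sub_sqrt_bounds (gridBase_pos hm x) (hflow τ x) (hfup τ x)
    (hflow τ' x) (hfup τ' x)
  have key := assouad_hellinger (κ := Fin d → Fin m) hn f hfmem hfmeas hf0 hfone
    (ENNReal.ofReal (ε ^ 2 / 8)) (fun τ τ' => by
      rw [← ENNReal.ofReal_natCast, ← ENNReal.ofReal_mul (by positivity),
        show (hammingDist τ τ' : ℝ) * (ε ^ 2 / 8) = 1 / 8 * (hammingDist τ τ' * ε ^ 2) by ring,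
        ← hchi _ (by norm_num)]
      exact lintegral_mono fun x => ENNReal.ofReal_le_ofReal (hbounds τ τ' x).1)
    (fun τ k => by
      have hham : (hammingDist τ (flipAt k τ) : ℝ) ≤ 1 := by
        have : hammingDist τ (flipAt k τ) ≤ 1 := by
          rw [hammingDist, Finset.card_le_one]
          have : ∀ l, τ l ≠ flipAt k τ l → l = k := fun l hl => by
            by_contra hlk
            exact hl (by simp [flipAt, hlk])
          intro l hl l' hl'
          rw [this l (by simpa using hl), this l' (by simpa using hl')]
        exact_mod_cast this
      calc hellingerSq (f τ) (f (flipAt k τ))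
          ≤ ENNReal.ofReal (1 / 2 * (hammingDist τ (flipAt k τ) * ε ^ 2)) := by
            rw [← hchi _ (by norm_num)]
            exact lintegral_mono fun x => ENNReal.ofReal_le_ofReal (hbounds _ _ x).2
        _ ≤ ENNReal.ofReal (1 / n) := by
            apply ENNReal.ofReal_le_ofReal
            nlinarith [sq_nonneg ε])
  refine le_trans (le_of_eq ?_) key
  rw [Fintype.card_fun, Fintype.card_fin, Fintype.card_fin, ← ENNReal.ofReal_natCast,
    ← ENNReal.ofReal_mul (by positivity), ← ENNReal.ofReal_ofNat 64,
    ← ENNReal.ofReal_div_of_pos (by norm_num)]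
  congr 1
  push_cast
  ring

end GaussianMixture

/-! ### Choice of parameters -/

theorem theorem2p2 (d : ℕ) (hd : 1 ≤ d) :
    ∃ c : ℝ, 0 < c ∧ ∀ Γ : ℝ, c⁻¹ ≤ Γ → ∀ n : ℕ, 2 ≤ n →
      ENNReal.ofReal (c * (Real.log n ^ d / n)) ≤
        GaussianMixture.minimaxHellingerRisk n
          (GaussianMixture.mixtureClass (GaussianMixture.subGaussianMixing d Γ)) := by
  have hd1 : (1 : ℝ) ≤ d := by exact_mod_cast hd
  -- `524288 = 2 * 262144`: the extra 2 absorbs `m ≤ 2 ^ m`, so the amplitude condition reduces to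
  -- `ε * b ^ m ≤ 1 / 2`.
  set b : ℝ := 524288 ^ d with hb
  have hb1 : 1 < b := one_lt_pow₀ (by norm_num) (by omega)
  have hb0 : 0 < b := by linarith
  have hlogb : 0 < Real.log b := Real.log_pos hb1
  -- Chosen so that `b ^ (a log n) = √n`.
  set a : ℝ := 1 / (2 * Real.log b) with ha
  have ha0 : 0 < a := by positivity
  -- The first term is the rate constant, with `2048 = 4 * 512`; the second forces `2 d ≤ Γ`.
  refine ⟨min (a ^ d / (2048 * b ^ 2)) (1 / (2 * d)), by positivity, fun Γ hΓ n hn => ?_⟩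
  have hΓd : 2 * d ≤ Γ := by
    refine le_trans ?_ hΓ
    rw [le_inv_comm₀ (by positivity) (by positivity), ← one_div]
    exact min_le_right _ _
  have hn0 : (0 : ℝ) < n := by positivity
  have hlogn : 0 ≤ Real.log n := Real.log_natCast_nonneg n
  set r : ℕ := ⌊a * Real.log n⌋₊ with hr
  -- Adding one ensures `1 ≤ m` and `a log n ≤ m`; it costs the single factor `b` in the denominator
  -- of `ε`.
  set m : ℕ := r + 1 with hm
  have hra : (r : ℝ) ≤ a * Real.log n := Nat.floor_le (by positivity)
  have hma : a * Real.log n ≤ m := by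
    rw [hm]; push_cast; exact (Nat.lt_floor_add_one _).le
  have hbr : b ^ r ≤ √n := by
    rw [← Real.exp_log (show 0 < b ^ r by positivity), Real.log_pow,
      ← Real.exp_log (Real.sqrt_pos.2 hn0), Real.log_sqrt hn0.le]
    apply Real.exp_le_exp.2
    calc (r : ℝ) * Real.log b ≤ a * Real.log n * Real.log b := by gcongr
      _ = Real.log n / 2 := by rw [ha]; field_simp
  have hsn : 0 < √(n : ℝ) := Real.sqrt_pos.2 hn0
  set ε : ℝ := 1 / (2 * b * √n) with hε
  have hε2 : ε ^ 2 = 1 / (4 * b ^ 2 * n) := by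
    rw [hε, div_pow, mul_pow, Real.sq_sqrt hn0.le]; ring
  refine le_trans ?_ (GaussianMixture.le_minimaxHellingerRisk (m := m) (n := n) (ε := ε) hd
    (by omega) (by omega) hΓd (by positivity) ?_ ?_)
  · apply ENNReal.ofReal_le_ofReal
    rw [hε2]
    calc min (a ^ d / (2048 * b ^ 2)) (1 / (2 * (d : ℝ))) * (Real.log n ^ d / n)
        ≤ a ^ d / (2048 * b ^ 2) * (Real.log n ^ d / n) := by
          gcongr; exact min_le_left _ _
      _ = (a * Real.log n) ^ d * (1 / (4 * b ^ 2 * n)) / 512 := by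
          rw [mul_pow]; field_simp; ring
      _ ≤ _ := by gcongr
  · have hm2 : (m : ℝ) ≤ 2 ^ m := by exact_mod_cast Nat.lt_two_pow_self.le
    calc ε * (m * 262144 ^ m) ^ d ≤ ε * (2 ^ m * 262144 ^ m) ^ d := by gcongr
      _ = ε * (b ^ r * b) := by
          rw [← mul_pow, ← pow_succ, hb, ← hm, ← pow_mul, ← pow_mul, mul_comm d m]; norm_num
      _ ≤ ε * (√n * b) := by gcongr
      _ = 1 / 2 := by rw [hε]; field_simp
  · rw [hε2, div_div, div_le_div_iff₀ (by positivity) hn0]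
    have hb2 : 1 ≤ b ^ 2 := one_le_pow₀ hb1.le
    nlinarith
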